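/- Let $n\ge 2$ and identify $\mathbb{C}^n$ with $\mathbb{R}^{2n}$ by $(\xi_{11}+i\xi_{12},\dots,\xi_{n1}+i\xi_{n2})\mapsto(\xi_{11},\xi_{12},\dots,\xi_{n1},\xi_{n2})$. For $\xi\in S^{2n-1}$ let $H_\xi=\{z\in\mathbb{C}^n:\sum_{k=1}^n z_k\overline{\xi_k}=0\}$, regarded as a $(2n-2)$-dimensional subspace of $\mathbb{R}^{2n}$. A star body is a compact set $K\subset\mathbb{R}^{2n}$ with the origin in its interior such that every line through the origin crosses the boundary of $K$ in exactly two points different from the origin; its Minkowski functional is $\|x\|_K=\min\{a\ge 0: x\in aK\}$. $K$ is called continuous if $\|\cdot\|_K$ is continuous on $\mathbb{R}^{2n}$, and $R_\theta$-invariant if $\|\cdot\|_K$ is invariant under the simultaneous rotation of all pairs of coordinates $(\xi_{k1},\xi_{k2})$ by every angle $\theta\in[0,2\pi]$. The volume of a section with respect to the volume element of complex hyperbolic $(n-1)$-space in the ball model is $$\mathrm{HVol}_{2n-2}(K\cap H_\xi)=8^{n-1}\int_{K\cap H_\xi}\frac{dx}{(1-|x|^2)^{n}},$$ where $dx$ is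 the $(2n-2)$-dimensional Lebesgue measure on $H_\xi$. The Fourier transform of test functions is $\hat\varphi(y)=\int_{\mathbb{R}^{2n}}\varphi(x)e^{-i(x,y)}\,dx$, and that of a tempered distribution $f$ is given by $\langle\hat f,\varphi\rangle=\langle f,\hat\varphi\rangle$. Let $K$ be a continuous $R_\theta$-invariant star body in $\mathbb{R}^{2n}$ contained in the open unit ball. Then the function $$f(x)=|x|^{-2n+2}\int_0^{|x|/\|x\|_K}\frac{r^{2n-3}}{(1-r^2)^n}\,dr$$ defines by integration a tempered distribution on $\mathbb{R}^{2n}$, whose Fourier transform $\hat f$ is given by a function that is continuous on $\mathbb{R}^{2n}\setminus\{0\}$, and for every $\xi\in S^{2n-1}$ the volume $\mathrm{HVol}_{2n-2}(K\cap H_\xi)$ is finite and $$\mathrm{HVol}_{2n-2}(K\cap H_\xi)=\frac{8^{n-1}}{2\pi}\,\hat f(\xi).$$ -/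

import Mathlib

namespace ComplexHyperbolic

open MeasureTheory

noncomputable section

/-- The space `ℝ^{2n}` with its Euclidean structure; the coordinates `ξ_{k1}, ξ_{k2}` of a
vector `ξ` are `ξ (k, 0)` and `ξ (k, 1)`. -/
abbrev RSpace (n : ℕ) : Type := EuclideanSpace ℝ (Fin n × Fin 2)

/-- The `k`-th complex coordinate `ξ_{k1} + i ξ_{k2}` under the identification of `ℝ^{2n}`
with `ℂ^n`. -/
def cCoord {n : ℕ} (x : RSpace n) (k : Fin n) : ℂ := ⟨x (k, 0), x (k, 1)⟩

/-- The complex hyperplane `H_ξ = {z | ∑ k, z_k * conj ξ_k = 0}`, as a real subspace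
of `ℝ^{2n}`. -/
def complexHyperplane {n : ℕ} (ξ : RSpace n) : Submodule ℝ (RSpace n) where
  carrier := {x | ∑ k, cCoord x k * (starRingEnd ℂ) (cCoord ξ k) = 0}
  add_mem' := by
    intro x y hx hy
    have h : ∀ k, cCoord (x + y) k = cCoord x k + cCoord y k := fun k => by
      apply Complex.ext <;> simp [cCoord]
    change ∑ k, _ = _ at hx hy
    change ∑ k, _ = _
    simp only [h, add_mul, Finset.sum_add_distrib, hx, hy, add_zero]
  zero_mem' := by
    have h : ∀ k, cCoord (0 : RSpace n) k = 0 := fun k => by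
      apply Complex.ext <;> simp [cCoord]
    simp [h]
  smul_mem' := by
    intro c x hx
    have h : ∀ k, cCoord (c • x) k = (c : ℂ) * cCoord x k := fun k => by
      apply Complex.ext <;> simp [cCoord]
    change ∑ k, _ = _ at hx
    change ∑ k, _ = _
    simp only [h, mul_assoc, ← Finset.mul_sum, hx, mul_zero]

/-- The counterclockwise rotation by the angle `θ` applied to each pair of coordinates
`(ξ_{k1}, ξ_{k2})`. -/
def rotate {n : ℕ} (θ : ℝ) (x : RSpace n) : RSpace n :=
  WithLp.toLp 2 fun p : Fin n × Fin 2 =>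
    if p.2 = 0 then Real.cos θ * x (p.1, 0) - Real.sin θ * x (p.1, 1)
    else Real.sin θ * x (p.1, 0) + Real.cos θ * x (p.1, 1)

/-- A star body: a compact set with the origin in its interior such that every line through the
origin crosses the boundary in exactly two points different from the origin. -/
structure IsStarBody {E : Type*} [NormedAddCommGroup E] [NormedSpace ℝ E] (K : Set E) : Prop where
  isCompact : IsCompact K
  zero_mem_interior : (0 : E) ∈ interior K
  encard_line : ∀ x : E, x ≠ 0 →
    (((Submodule.span ℝ {x} : Submodule ℝ E) : Set E) ∩ (frontier K \ {0})).encard = 2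

/-- `R_θ`-invariance, in terms of the Minkowski functional `gauge K`. -/
def IsRotationInvariant {n : ℕ} (K : Set (RSpace n)) : Prop :=
  ∀ θ ∈ Set.Icc (0 : ℝ) (2 * Real.pi), ∀ x : RSpace n, gauge K x = gauge K (rotate θ x)

/-- The volume measure of complex hyperbolic `m`-space in the ball model, on the open unit ball of
a `2m`-dimensional Euclidean space `V`: it has the density `8 ^ m / (1 - r ^ 2) ^ (m + 1)` with
respect to Lebesgue measure `r ^ (2 m - 1) dr dσ`. -/
def hypMeasure (m : ℕ) (V : Type*) [NormedAddCommGroup V] [InnerProductSpace ℝ V]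
    [FiniteDimensional ℝ V] [MeasurableSpace V] [BorelSpace V] : Measure V :=
  (volume.restrict (Metric.ball (0 : V) 1)).withDensity
    fun x => ENNReal.ofReal (8 ^ m / (1 - ‖x‖ ^ 2) ^ (m + 1))

/-- The hyperbolic volume `HVol_{2n-2}(K ∩ H_ξ)` of a section by a complex hyperplane. -/
def hypSectionVolume {n : ℕ} (K : Set (RSpace n)) (ξ : RSpace n) : ENNReal :=
  hypMeasure (n - 1) (complexHyperplane ξ) {x | (x : RSpace n) ∈ K}

section Fourier

variable {E : Type*} [NormedAddCommGroup E] [InnerProductSpace ℝ E] [FiniteDimensional ℝ E]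
  [MeasurableSpace E] [BorelSpace E]

variable (E) in
/-- The Fourier transform `φ ↦ (y ↦ ∫ φ(x) exp(-i⟨x, y⟩) dx)` on Schwartz functions, obtained by
rescaling Mathlib's transform, whose kernel is `exp(-2πi⟨x, y⟩)`. -/
def schwartzFourier : SchwartzMap E ℂ →L[ℂ] SchwartzMap E ℂ :=
  (SchwartzMap.compCLMOfContinuousLinearEquiv ℂ
    (ContinuousLinearEquiv.smulLeft
      (Units.mk0 ((2 * Real.pi)⁻¹ : ℝ) (by positivity)) : E ≃L[ℝ] E)).comp
    (FourierTransform.fourierCLM ℂ (SchwartzMap E ℂ))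

theorem schwartzFourier_apply (φ : SchwartzMap E ℂ) (y : E) :
    schwartzFourier E φ y = ∫ x, Complex.exp (-((inner ℝ x y : ℝ) : ℂ) * Complex.I) * φ x := by
  have h : schwartzFourier E φ y =
      FourierTransform.fourier (φ : E → ℂ) ((2 * Real.pi)⁻¹ • y) := by
    rw [← SchwartzMap.fourier_coe]; rfl
  rw [h, Real.fourier_eq']
  refine integral_congr_ae (Filter.Eventually.of_forall fun x => ?_)
  have hpi : (Real.pi : ℂ) ≠ 0 := by exact_mod_cast Real.pi_ne_zero
  simp only [inner_smul_right, smul_eq_mul]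
  congr 2
  push_cast
  field_simp

/-- The Fourier transform of a tempered distribution, `⟨T^, φ⟩ = ⟨T, φ^⟩`. -/
def distFourier (T : TemperedDistribution E ℂ) : TemperedDistribution E ℂ :=
  PointwiseConvergenceCLM.precomp ℂ (schwartzFourier E) T

theorem distFourier_apply (T : TemperedDistribution E ℂ) (φ : SchwartzMap E ℂ) :
    distFourier T φ = T (schwartzFourier E φ) := rfl

/-- The tempered distribution `T` is given by integration against the function `f`. -/
def IsGivenBy (T : TemperedDistribution E ℂ) (f : E → ℝ) : Prop :=
  ∀ φ : SchwartzMap E ℂ,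
    Integrable (fun x => (f x : ℂ) * φ x) ∧ T φ = ∫ x, (f x : ℂ) * φ x

end Fourier

/-- The function `x ↦ |x|^{-2n+2} ∫_0^{|x| / ‖x‖_K} r^{2n-3} (1 - r^2)^{-n} dr`. -/
def sectionKernel {n : ℕ} (K : Set (RSpace n)) (x : RSpace n) : ℝ :=
  ‖x‖ ^ (-2 * (n : ℤ) + 2) *
    ∫ r in (0 : ℝ)..(‖x‖ / gauge K x), r ^ (2 * n - 3) / (1 - r ^ 2) ^ n

end

end ComplexHyperbolic

/-! Write f for `sectionKernel K` and D for `bodyDensity K`. The substitution r = t|x| turns f into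
the radial integral f(x) = ∫_0^∞ t^(2n-3) D(tx) dt. So f is homogeneous of degree -(2n-2), and by
rotation invariance f(zx) = |z|^(-(2n-2)) f(x) for complex z ≠ 0.

Let P = `lineFourier`, with Pφ(x) = ∫_ℂ φ^(zx) dz. The Fourier slice theorem gives Pφ(x) = (2π)²
|x|^(-2) ∫_{H_x} φ (`lineFourier_eq`). P is symmetric, ∫ φ Pψ = ∫ ψ Pφ (`integral_mul_lineFourier`),
because the adjoint of multiplication by z is multiplication by its conjugate.

The function f is singular at 0 and has no compact support, so it is replaced by h(x) = f(x) w(|x|),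
with w supported in an annulus and ∫ w(s) ds/s = 1. Averaging over dilations shows two things. The
integral of h over H_ξ equals that of D, which is the section volume up to 8^(n-1)
(`lintegral_kernelCutoff`). Substituting y ↦ z⁻¹y also gives ∫ h Pφ = 2π ∫ f φ^
(`integral_kernelCutoff_mul_lineFourier`).

Since h is continuous with compact support, it is a uniform limit of Schwartz functions, and
symmetry of P passes to the limit: ∫ h Pφ = ∫ φ(x) (2π)² |x|^(-2) (∫_{H_x} h) dx
(`integral_hyperplaneIntegral_eq`). Comparing the two expressions, f^(x) = 2π |x|^(-2) ∫_{H_x} h,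
which is continuous off 0 and has the required value on the sphere. -/

namespace ComplexHyperbolic

open MeasureTheory Filter Topology Set FourierTransform

noncomputable section

/-! ### Rapid decay and integrable singularities -/

section Decay

variable {E : Type*} [NormedAddCommGroup E] [InnerProductSpace ℝ E]

/-- Rapid decay of a Schwartz function, in a multiplicative form. -/
theorem exists_norm_schwartz_le (φ : SchwartzMap E ℂ) (N : ℕ) :
    ∃ C, 0 ≤ C ∧ ∀ x, ‖φ x‖ ≤ C * ((1 + ‖x‖) ^ N)⁻¹ := by
  refine ⟨2 ^ N * ((Finset.Iic (N, 0)).sup fun m => SchwartzMap.seminorm ℝ m.1 m.2) φ,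
    by positivity, fun x => ?_⟩
  have h := SchwartzMap.one_add_le_sup_seminorm_apply (𝕜 := ℝ) (m := (N, 0)) (le_refl N)
    (le_refl 0) φ x
  rw [norm_iteratedFDeriv_zero] at h
  rw [← div_eq_mul_inv, le_div_iff₀ (by positivity)]
  linarith

theorem norm_le_norm_add_orthogonal (K : Submodule ℝ E) (u : K) (y : Kᗮ) :
    ‖(y : E)‖ ≤ ‖(u : E) + y‖ := by
  have h : inner ℝ (u : E) (y : E) = 0 := K.inner_right_of_mem_orthogonal u.2 y.2
  have := norm_add_sq_eq_norm_sq_add_norm_sq_real h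
  nlinarith [norm_nonneg (y : E), norm_nonneg ((u : E) + y), mul_self_nonneg ‖(u : E)‖]

variable [FiniteDimensional ℝ E] [MeasurableSpace E] [BorelSpace E]

theorem integrable_inv_one_add_norm_pow {N : ℕ} (hN : Module.finrank ℝ E < N) :
    Integrable fun x : E => ((1 + ‖x‖) ^ N)⁻¹ := by
  have h := integrable_one_add_norm (E := E) (μ := volume) (r := N) (by exact_mod_cast hN)
  refine h.congr (Eventually.of_forall fun x => ?_)
  simp [Real.rpow_neg (by positivity : (0 : ℝ) ≤ 1 + ‖x‖)]

/-- A negative power of the norm above the critical exponent, with enough decay at infinity. -/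
theorem integrable_inv_norm_pow_mul [Nontrivial E] {k : ℕ} (hk : k < Module.finrank ℝ E) :
    Integrable fun x : E => (‖x‖ ^ k)⁻¹ * ((1 + ‖x‖) ^ (Module.finrank ℝ E + 1))⁻¹ := by
  set d := Module.finrank ℝ E with hd
  refine (integrable_fun_norm_addHaar (volume : Measure E)
    (f := fun r => (r ^ k)⁻¹ * ((1 + r) ^ (d + 1))⁻¹)).2 ?_
  have h2 : IntegrableOn (fun r : ℝ => ((1 + ‖r‖) ^ 2)⁻¹) (Ioi 0) :=
    (integrable_inv_one_add_norm_pow (E := ℝ) (by simp)).integrableOn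
  refine Integrable.mono' h2 (by fun_prop) ?_
  refine (ae_restrict_iff' measurableSet_Ioi).2 (Eventually.of_forall fun r (hr : 0 < r) => ?_)
  rw [smul_eq_mul, Real.norm_of_nonneg (by positivity), Real.norm_of_nonneg hr.le, ← hd]
  -- The polar Jacobian r^(d-1) absorbs r^(-k), leaving at most (1+r)^(d-1) against (1+r)^(-(d+1)).
  have e : d - 1 = (d - 1 - k) + k := by omega
  rw [e, pow_add, mul_assoc, mul_inv_cancel_left₀ (by positivity), ← div_eq_mul_inv,
    div_le_iff₀ (by positivity), ← div_eq_inv_mul, le_div_iff₀ (by positivity)]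
  calc r ^ (d - 1 - k) * (1 + r) ^ 2 ≤ (1 + r) ^ (d - 1 - k) * (1 + r) ^ 2 := by
        gcongr; linarith
    _ = (1 + r) ^ (d - 1 - k + 2) := by rw [pow_add]
    _ ≤ (1 + r) ^ (d + 1) := pow_le_pow_right₀ (by linarith) (by omega)

/-- A Schwartz function may be multiplied by a function with an integrable singularity at `0`. -/
theorem integrable_mul_schwartz [Nontrivial E] {k : ℕ} (hk : k < Module.finrank ℝ E)
    {F : E → ℂ} (hF : AEStronglyMeasurable F) {C : ℝ}
    (hFC : ∀ᵐ x, ‖F x‖ ≤ C * (‖x‖ ^ k)⁻¹) (φ : SchwartzMap E ℂ) :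
    Integrable fun x => F x * φ x := by
  obtain ⟨D, hD, hφ⟩ := exists_norm_schwartz_le φ (Module.finrank ℝ E + 1)
  refine ((integrable_inv_norm_pow_mul hk).const_mul (C * D)).mono'
    (hF.mul φ.continuous.aestronglyMeasurable) ?_
  filter_upwards [hFC] with x hx
  rw [norm_mul]
  calc ‖F x‖ * ‖φ x‖ ≤ (C * (‖x‖ ^ k)⁻¹) * (D * ((1 + ‖x‖) ^ (Module.finrank ℝ E + 1))⁻¹) :=
        mul_le_mul hx (hφ x) (norm_nonneg _) ((norm_nonneg _).trans hx)
    _ = _ := by ring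

end Decay

/-! ### Fourier slice theorem -/

section Slice

variable {E : Type*} [NormedAddCommGroup E] [InnerProductSpace ℝ E] [FiniteDimensional ℝ E]
  [MeasurableSpace E] [BorelSpace E]

theorem measurePreserving_add_orthogonal (K : Submodule ℝ E) :
    MeasurePreserving (fun p : K × Kᗮ => (p.1 : E) + p.2) := by
  have h := K.orthogonalDecomposition.symm.measurePreserving.comp
    (WithLp.volume_preserving_symm_measurableEquiv_toLp_prod K Kᗮ).symm
  convert h using 1
  funext p
  simp

theorem measurableEmbedding_add_orthogonal (K : Submodule ℝ E) :
    MeasurableEmbedding (fun p : K × Kᗮ => (p.1 : E) + p.2) := by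
  have h := (K.orthogonalDecomposition.symm.toHomeomorph.measurableEmbedding).comp
    (MeasurableEquiv.toLp 2 (K × Kᗮ)).measurableEmbedding
  convert h using 1
  funext p
  simp

/-- **Fourier slice theorem**: the integral of `𝓕 φ` over a subspace is the integral of `φ` over
its orthogonal complement. -/
theorem integral_fourier_subspace (K : Submodule ℝ E) (φ : SchwartzMap E ℂ) :
    ∫ w : K, 𝓕 (φ : E → ℂ) w = ∫ y : Kᗮ, φ y := by
  have hmp := measurePreserving_add_orthogonal K
  have hemb := measurableEmbedding_add_orthogonal K
  have hint : Integrable (fun p : K × Kᗮ => φ ((p.1 : E) + p.2)) :=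
    (hmp.integrable_comp_emb hemb).2 φ.integrable
  -- The marginal of φ on K: its Fourier transform is the restriction of 𝓕 φ to K, and Fourier
  -- inversion at 0 is the claim.
  set Φ : K → ℂ := fun u => ∫ y : Kᗮ, φ ((u : E) + y) with hΦ
  have hΦint : Integrable Φ := hint.integral_prod_left
  have hΦcont : Continuous Φ := by
    obtain ⟨C, hC, hφ⟩ := exists_norm_schwartz_le φ (Module.finrank ℝ Kᗮ + 1)
    refine continuous_of_dominated
      (bound := fun y : Kᗮ => C * ((1 + ‖y‖) ^ (Module.finrank ℝ Kᗮ + 1))⁻¹) ?_ ?_ ?_ ?_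
    · intro u
      have : Continuous fun y : Kᗮ => φ ((u : E) + y) := by fun_prop
      exact this.aestronglyMeasurable
    · intro u
      refine Eventually.of_forall fun y => (hφ _).trans ?_
      gcongr
      exact norm_le_norm_add_orthogonal K u y
    · exact (integrable_inv_one_add_norm_pow (by simp)).const_mul C
    · exact Eventually.of_forall fun y => by fun_prop
  have hF : ∀ w : K, 𝓕 Φ w = 𝓕 (φ : E → ℂ) w := by
    intro w
    rw [Real.fourier_eq', Real.fourier_eq', ← hmp.integral_comp hemb]
    have hi : Integrable (fun p : K × Kᗮ =>
        Complex.exp (↑(-2 * Real.pi * inner ℝ ((p.1 : E) + p.2) (w : E)) * Complex.I) •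
          φ ((p.1 : E) + p.2)) := by
      refine hint.bdd_mul (c := 1) ?_ (Eventually.of_forall fun p => ?_)
      · have : Continuous fun p : K × Kᗮ =>
          Complex.exp (↑(-2 * Real.pi * inner ℝ ((p.1 : E) + p.2) (w : E)) * Complex.I) := by
          fun_prop
        exact this.aestronglyMeasurable
      · rw [Complex.norm_exp_ofReal_mul_I]
    rw [Measure.volume_eq_prod, integral_prod _ hi]
    refine integral_congr_ae (Eventually.of_forall fun u => ?_)
    simp only [hΦ]
    rw [← integral_smul]
    refine integral_congr_ae (Eventually.of_forall fun y => ?_)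
    have : inner ℝ (y : E) (w : E) = 0 := K.inner_left_of_mem_orthogonal w.2 y.2
    simp [inner_add_left, this]
  -- The restriction of a Schwartz function to a subspace still decays rapidly, so inversion
  -- applies.
  have hFint : Integrable (𝓕 Φ) := by
    have h1 : 𝓕 Φ = fun w : K => (𝓕 φ) (w : E) := by
      funext w
      rw [hF w, SchwartzMap.fourier_coe]
    rw [h1]
    obtain ⟨C, hC, hφ⟩ := exists_norm_schwartz_le (𝓕 φ) (Module.finrank ℝ K + 1)
    refine ((integrable_inv_one_add_norm_pow (E := K) (N := Module.finrank ℝ K + 1)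
      (by simp)).const_mul C).mono' ?_ (Eventually.of_forall fun w => ?_)
    · have : Continuous fun w : K => (𝓕 φ) (w : E) := by fun_prop
      exact this.aestronglyMeasurable
    · exact hφ w
  have key := congrFun (hΦcont.fourierInv_fourier_eq hΦint hFint) 0
  rw [Real.fourierInv_eq'] at key
  simp only [inner_zero_right, mul_zero, Complex.ofReal_zero, zero_mul, Complex.exp_zero,
    one_smul, hF] at key
  rw [key, hΦ]
  simp

end Slice

/-! ### Complex scalars acting on ℝ^{2n} -/

section ComplexStructure

variable {n : ℕ}

theorem cCoord_ext {x y : RSpace n} (h : ∀ k, cCoord x k = cCoord y k) : x = y := by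
  ext ⟨k, i⟩
  have h1 := congrArg Complex.re (h k)
  have h2 := congrArg Complex.im (h k)
  fin_cases i
  · exact h1
  · exact h2

theorem cCoord_add (x y : RSpace n) (k : Fin n) : cCoord (x + y) k = cCoord x k + cCoord y k := by
  apply Complex.ext <;> simp [cCoord]

theorem cCoord_smul (c : ℝ) (x : RSpace n) (k : Fin n) : cCoord (c • x) k = c * cCoord x k := by
  apply Complex.ext <;> simp [cCoord]

/-- The vector with given complex coordinates. -/
def ofCCoord (z : Fin n → ℂ) : RSpace n :=
  WithLp.toLp 2 fun p => if p.2 = 0 then (z p.1).re else (z p.1).im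

@[simp] theorem cCoord_ofCCoord (z : Fin n → ℂ) (k : Fin n) : cCoord (ofCCoord z) k = z k := by
  apply Complex.ext <;> simp [cCoord, ofCCoord]

variable (n) in
/-- Multiplication by complex scalars on `ℝ^{2n}`. -/
def cmul : ℂ →ₗ[ℝ] RSpace n →ₗ[ℝ] RSpace n :=
  LinearMap.mk₂ ℝ (fun z x => ofCCoord fun k => z * cCoord x k)
    (fun z w x => cCoord_ext fun k => by simp [cCoord_add, add_mul])
    (fun c z x => cCoord_ext fun k => by simp [cCoord_smul, mul_assoc])
    (fun z x y => cCoord_ext fun k => by simp [cCoord_add, mul_add])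
    (fun c z x => cCoord_ext fun k => by simp [cCoord_smul, mul_left_comm])

@[simp] theorem cCoord_cmul (z : ℂ) (x : RSpace n) (k : Fin n) :
    cCoord (cmul n z x) k = z * cCoord x k := by
  simp [cmul]

theorem cmul_ofReal (c : ℝ) (x : RSpace n) : cmul n c x = c • x :=
  cCoord_ext fun k => by simp [cCoord_smul]

@[simp] theorem cmul_one (x : RSpace n) : cmul n 1 x = x := cCoord_ext fun k => by simp

theorem cmul_mul (z w : ℂ) (x : RSpace n) : cmul n (z * w) x = cmul n z (cmul n w x) :=
  cCoord_ext fun k => by simp [mul_assoc]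

theorem rotate_eq_cmul (θ : ℝ) (x : RSpace n) :
    rotate θ x = cmul n (Complex.exp (θ * Complex.I)) x := by
  refine cCoord_ext fun k => ?_
  rw [cCoord_cmul, Complex.exp_mul_I, ← Complex.ofReal_cos, ← Complex.ofReal_sin]
  apply Complex.ext <;> simp only [cCoord, rotate, Complex.mul_re, Complex.mul_im, Complex.add_re,
    Complex.add_im, Complex.ofReal_re, Complex.ofReal_im, Complex.I_re, Complex.I_im] <;>
    simp <;> ring

theorem inner_eq_re_sum (x y : RSpace n) :
    inner ℝ x y = (∑ k, cCoord x k * (starRingEnd ℂ) (cCoord y k)).re := by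
  rw [PiLp.inner_apply, Fintype.sum_prod_type, Complex.re_sum]
  refine Finset.sum_congr rfl fun k _ => ?_
  simp [cCoord, Fin.sum_univ_two]
  ring

theorem inner_cmul_left (z : ℂ) (x y : RSpace n) :
    inner ℝ (cmul n z x) y = inner ℝ x (cmul n ((starRingEnd ℂ) z) y) := by
  rw [inner_eq_re_sum, inner_eq_re_sum]
  congr 1
  refine Finset.sum_congr rfl fun k _ => ?_
  simp only [cCoord_cmul, map_mul, Complex.conj_conj]
  ring

@[simp] theorem norm_cmul (z : ℂ) (x : RSpace n) : ‖cmul n z x‖ = ‖z‖ * ‖x‖ := by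
  have h : ‖cmul n z x‖ ^ 2 = (‖z‖ * ‖x‖) ^ 2 := by
    rw [← real_inner_self_eq_norm_sq, inner_cmul_left, ← cmul_mul, mul_comm, Complex.mul_conj,
      cmul_ofReal, inner_smul_right, real_inner_self_eq_norm_sq, mul_pow, Complex.normSq_eq_norm_sq]
  exact (pow_left_inj₀ (norm_nonneg _) (by positivity) two_ne_zero).1 h

theorem continuous_cmul : Continuous fun p : ℂ × RSpace n => cmul n p.1 p.2 := by
  have h : Continuous fun p : ℂ × RSpace n =>
      LinearMap.toContinuousLinearMap
        ((LinearMap.toContinuousLinearMap : _ ≃ₗ[ℝ] (RSpace n →L[ℝ] RSpace n)).toLinearMap ∘ₗ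
          cmul n) p.1 p.2 := by fun_prop
  exact h

@[fun_prop]
theorem Continuous.cmul {X : Type*} [TopologicalSpace X] {f : X → ℂ} {g : X → RSpace n}
    (hf : Continuous f) (hg : Continuous g) : Continuous fun x => cmul n (f x) (g x) :=
  continuous_cmul.comp (hf.prodMk hg)

/-- If c is the Hermitian product of y and x, the real inner product of y with zx is Re(z̄c). It
vanishes for all z exactly when c = 0, as z = c shows. -/
theorem complexHyperplane_eq_orthogonal (x : RSpace n) :
    complexHyperplane x = (LinearMap.range ((cmul n).flip x))ᗮ := by
  ext y
  have hy : y ∈ complexHyperplane x ↔ ∑ k, cCoord y k * (starRingEnd ℂ) (cCoord x k) = 0 := Iff.rfl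
  rw [hy, Submodule.mem_orthogonal']
  have key : ∀ z : ℂ, inner ℝ y (cmul n z x) =
      ((starRingEnd ℂ) z * ∑ k, cCoord y k * (starRingEnd ℂ) (cCoord x k)).re := by
    intro z
    rw [inner_eq_re_sum, Finset.mul_sum]
    congr 1
    refine Finset.sum_congr rfl fun k _ => ?_
    simp only [cCoord_cmul, map_mul]
    ring
  constructor
  · rintro h _ ⟨z, rfl⟩
    rw [LinearMap.flip_apply, key, h]
    simp
  · intro h
    set c := ∑ k, cCoord y k * (starRingEnd ℂ) (cCoord x k)
    have := h _ ⟨c, rfl⟩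
    rw [LinearMap.flip_apply, key, mul_comm, Complex.mul_conj, Complex.ofReal_re] at this
    exact Complex.normSq_eq_zero.1 this

theorem complexHyperplane_smul {c : ℝ} (hc : c ≠ 0) (x : RSpace n) :
    complexHyperplane (c • x) = complexHyperplane x := by
  ext y
  change ∑ k, _ = _ ↔ ∑ k, _ = _
  have : ∀ k, cCoord y k * (starRingEnd ℂ) (cCoord (c • x) k) =
      c * (cCoord y k * (starRingEnd ℂ) (cCoord x k)) := fun k => by
    rw [cCoord_smul, map_mul, Complex.conj_ofReal]
    ring
  simp [this, ← Finset.mul_sum, hc]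

/-- The isometry `z ↦ z x` for a unit vector `x`. -/
def cmulUnit (x : RSpace n) (hx : ‖x‖ = 1) : ℂ →ₗᵢ[ℝ] RSpace n where
  toLinearMap := (cmul n).flip x
  norm_map' z := by simp [hx]

theorem finrank_complexHyperplane {x : RSpace n} (hx : x ≠ 0) :
    Module.finrank ℝ (complexHyperplane x) = 2 * n - 2 := by
  have h := (LinearMap.range ((cmul n).flip x)).finrank_add_finrank_orthogonal
  rw [← complexHyperplane_eq_orthogonal, LinearMap.finrank_range_of_inj, Complex.finrank_real_complex,
    finrank_euclideanSpace, Fintype.card_prod, Fintype.card_fin, Fintype.card_fin] at h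
  · omega
  · rw [← LinearMap.ker_eq_bot, LinearMap.ker_eq_bot']
    intro z hz
    have : ‖z‖ * ‖x‖ = 0 := by
      rw [← norm_cmul]
      exact norm_eq_zero.2 hz
    simpa [hx] using this

/-- Multiplication by a complex number of modulus one, as an isometry. -/
def cmulIsometry (u : ℂ) (hu : ‖u‖ = 1) : RSpace n ≃ₗᵢ[ℝ] RSpace n :=
  LinearIsometry.toLinearIsometryEquiv
    { toLinearMap := cmul n u, norm_map' := fun x => by simp [hu] } rfl

/-- Multiplication by z is the isometry z/|z| followed by the dilation |z| in real dimension 2n. -/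
theorem integral_comp_cmul {F : Type*} [NormedAddCommGroup F] [NormedSpace ℝ F]
    (f : RSpace n → F) {z : ℂ} (hz : z ≠ 0) :
    ∫ y, f (cmul n z y) = (‖z‖ ^ (2 * n))⁻¹ • ∫ y, f y := by
  have hz' : ‖z‖ ≠ 0 := norm_ne_zero_iff.2 hz
  have hu : ‖z / ‖z‖‖ = 1 := by simp [hz']
  have h : ∀ y, cmul n z y = ‖z‖ • cmulIsometry (z / ‖z‖) hu y := fun y => by
    change _ = ‖z‖ • cmul n (z / ‖z‖) y
    rw [← cmul_ofReal, ← cmul_mul, mul_div_cancel₀ _ (by exact_mod_cast hz')]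
  simp_rw [h]
  rw [(cmulIsometry (n := n) (z / ‖z‖) hu).measurePreserving.integral_comp
    (cmulIsometry (n := n) (z / ‖z‖) hu).toHomeomorph.measurableEmbedding (fun y => f (‖z‖ • y)),
    Measure.integral_comp_smul_of_nonneg _ _ _ (hR := norm_nonneg z), finrank_euclideanSpace,
    Fintype.card_prod, Fintype.card_fin, Fintype.card_fin, mul_comm n 2]

end ComplexStructure

/-! ### Integrals over complex lines and complex hyperplanes -/

section HyperplaneIntegral

variable {n : ℕ}

/-- The integral of a function over the complex hyperplane `H_x`. -/
def hyperplaneIntegral (F : RSpace n → ℂ) (x : RSpace n) : ℂ :=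
  ∫ y : complexHyperplane x, F y

/-- The integral of the Fourier transform of a test function over the complex line through `x`. -/
def lineFourier (φ : SchwartzMap (RSpace n) ℂ) (x : RSpace n) : ℂ :=
  ∫ z : ℂ, schwartzFourier (RSpace n) φ (cmul n z x)

theorem integral_submodule_congr {K L : Submodule ℝ (RSpace n)} (h : K = L) (F : RSpace n → ℂ) :
    ∫ y : K, F y = ∫ y : L, F y := by
  subst h
  rfl

theorem hyperplaneIntegral_smul (F : RSpace n → ℂ) {c : ℝ} (hc : c ≠ 0) (x : RSpace n) :
    hyperplaneIntegral F (c • x) = hyperplaneIntegral F x :=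
  integral_submodule_congr (complexHyperplane_smul hc x) F

/-- The slice theorem for the complex line through x, which ℂ parametrises isometrically and whose
orthogonal complement is H_x. -/
theorem integral_fourier_cmul (φ : SchwartzMap (RSpace n) ℂ) {x : RSpace n} (hx : ‖x‖ = 1) :
    ∫ z : ℂ, 𝓕 (φ : RSpace n → ℂ) (cmul n z x) = hyperplaneIntegral φ x := by
  unfold hyperplaneIntegral
  rw [integral_submodule_congr (complexHyperplane_eq_orthogonal x), ← integral_fourier_subspace]
  exact ((cmulUnit x hx).equivRange.measurePreserving).integral_comp
    (cmulUnit x hx).equivRange.toHomeomorph.measurableEmbedding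
    (fun w => 𝓕 (φ : RSpace n → ℂ) (w : RSpace n))

theorem schwartzFourier_eq (φ : SchwartzMap (RSpace n) ℂ) (y : RSpace n) :
    schwartzFourier (RSpace n) φ y = 𝓕 (φ : RSpace n → ℂ) ((2 * Real.pi)⁻¹ • y) := by
  rw [← SchwartzMap.fourier_coe]; rfl

/-- Rescaling z by |x|/(2π) in the real plane ℂ reduces to a unit vector and to the 2π-normalised
transform; the squared inverse of this scale is the factor. -/
theorem lineFourier_eq (φ : SchwartzMap (RSpace n) ℂ) {x : RSpace n} (hx : x ≠ 0) :
    lineFourier φ x = ((2 * Real.pi) ^ 2 * (‖x‖ ^ 2)⁻¹ : ℝ) * hyperplaneIntegral φ x := by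
  have hx' : ‖x‖ ≠ 0 := norm_ne_zero_iff.2 hx
  have hu : ‖‖x‖⁻¹ • x‖ = 1 := by simp [norm_smul, hx']
  have h : ∀ z : ℂ, (2 * Real.pi)⁻¹ • cmul n z x =
      cmul n (((2 * Real.pi)⁻¹ * ‖x‖) • z) (‖x‖⁻¹ • x) := fun z => by
    rw [map_smul, map_smul, LinearMap.smul_apply, smul_smul]
    congr 1
    field_simp
  unfold lineFourier
  simp_rw [schwartzFourier_eq, h]
  rw [Measure.integral_comp_smul_of_nonneg volume
    (fun z : ℂ => 𝓕 (φ : RSpace n → ℂ) (cmul n z (‖x‖⁻¹ • x))) _ (hR := by positivity),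
    integral_fourier_cmul φ hu, hyperplaneIntegral_smul _ (inv_ne_zero hx'),
    Complex.finrank_real_complex, Complex.real_smul]
  congr 2
  rw [mul_pow, mul_inv, inv_pow, inv_inv]

end HyperplaneIntegral

theorem aestronglyMeasurable_of_continuousOn_compl_zero {E F : Type*} [NormedAddCommGroup E]
    [MeasurableSpace E] [BorelSpace E] [SecondCountableTopology E] {μ : Measure E} [NullSingletonClass μ]
    [TopologicalSpace F] [TopologicalSpace.PseudoMetrizableSpace F]
    {f : E → F} (hf : ContinuousOn f {0}ᶜ) : AEStronglyMeasurable f μ := by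
  have h := hf.aestronglyMeasurable (μ := μ) (measurableSet_singleton (0 : E)).compl
  rwa [restrict_compl_singleton] at h

theorem finrank_rSpace (n : ℕ) : Module.finrank ℝ (RSpace n) = 2 * n := by
  rw [finrank_euclideanSpace, Fintype.card_prod, Fintype.card_fin, Fintype.card_fin, mul_comm]

/-! ### The operator `lineFourier` and its symmetry -/

section LineFourier

variable {n : ℕ}

theorem integral_inv_one_add_norm_mul_pow {r : ℝ} (hr : 0 < r) :
    ∫ z : ℂ, ((1 + ‖z‖ * r) ^ 3)⁻¹ = (r ^ 2)⁻¹ * ∫ z : ℂ, ((1 + ‖z‖) ^ 3)⁻¹ := by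
  have h := Measure.integral_comp_smul_of_nonneg (volume : Measure ℂ)
    (fun z : ℂ => ((1 + ‖z‖) ^ 3)⁻¹) r (hR := hr.le)
  rw [Complex.finrank_real_complex, smul_eq_mul] at h
  rw [← h]
  simp only [norm_smul, Real.norm_of_nonneg hr.le, mul_comm r]

theorem integrable_inv_one_add_norm_mul_pow {r : ℝ} (hr : 0 < r) :
    Integrable fun z : ℂ => ((1 + ‖z‖ * r) ^ 3)⁻¹ := by
  have h := (integrable_inv_one_add_norm_pow (E := ℂ) (N := 3) (by simp)).comp_smul hr.ne'
  simpa only [norm_smul, Real.norm_of_nonneg hr.le, mul_comm r] using h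

/-- Decay of order 3 is integrable over the plane ℂ, and rescaling z by |x| produces |x|^(-2). -/
theorem norm_lineFourier_le (φ : SchwartzMap (RSpace n) ℂ) :
    ∃ C, 0 ≤ C ∧ ∀ x, x ≠ 0 → ‖lineFourier φ x‖ ≤ C * (‖x‖ ^ 2)⁻¹ := by
  obtain ⟨D, hD, h⟩ := exists_norm_schwartz_le (schwartzFourier (RSpace n) φ) 3
  refine ⟨D * ∫ z : ℂ, ((1 + ‖z‖) ^ 3)⁻¹,
    mul_nonneg hD (integral_nonneg fun z => by positivity), fun x hx => ?_⟩
  have hx' : 0 < ‖x‖ := norm_pos_iff.2 hx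
  calc ‖lineFourier φ x‖ ≤ ∫ z : ℂ, D * ((1 + ‖z‖ * ‖x‖) ^ 3)⁻¹ := by
        refine norm_integral_le_of_norm_le
          ((integrable_inv_one_add_norm_mul_pow hx').const_mul D)
          (Eventually.of_forall fun z => ?_)
        rw [← norm_cmul]
        exact h _
    _ = _ := by
        rw [integral_const_mul, integral_inv_one_add_norm_mul_pow hx']
        ring

theorem continuousOn_lineFourier (φ : SchwartzMap (RSpace n) ℂ) :
    ContinuousOn (lineFourier φ) {0}ᶜ := by
  intro x₀ hx₀
  have hpos : 0 < ‖x₀‖ := norm_pos_iff.2 hx₀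
  obtain ⟨D, hD, h⟩ := exists_norm_schwartz_le (schwartzFourier (RSpace n) φ) 3
  refine ContinuousAt.continuousWithinAt ?_
  refine continuousAt_of_dominated (bound := fun z => D * ((1 + ‖z‖ * (‖x₀‖ / 2)) ^ 3)⁻¹)
    (Eventually.of_forall fun x => ?_) ?_ ?_ (Eventually.of_forall fun z => ?_)
  · have : Continuous fun z : ℂ => schwartzFourier (RSpace n) φ (cmul n z x) := by fun_prop
    exact this.aestronglyMeasurable
  -- Keeping x away from 0 gives a majorant that depends on z only.
  · have : ∀ᶠ x in 𝓝 x₀, ‖x₀‖ / 2 < ‖x‖ :=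
      continuous_norm.continuousAt.eventually (lt_mem_nhds (by linarith))
    filter_upwards [this] with x hx
    refine Eventually.of_forall fun z => (h _).trans ?_
    rw [norm_cmul]
    gcongr
  · exact (integrable_inv_one_add_norm_mul_pow (by linarith)).const_mul D
  · have : Continuous fun x : RSpace n => schwartzFourier (RSpace n) φ (cmul n z x) := by fun_prop
    exact this.continuousAt

/-- Fubini, together with ⟨y, zx⟩ = ⟨x, z̄y⟩ in the exponent. -/
theorem integral_mul_schwartzFourier_cmul (φ ψ : SchwartzMap (RSpace n) ℂ) (z : ℂ) :
    ∫ x, φ x * schwartzFourier (RSpace n) ψ (cmul n z x) =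
      ∫ y, ψ y * schwartzFourier (RSpace n) φ (cmul n ((starRingEnd ℂ) z) y) := by
  have hint : Integrable (fun p : RSpace n × RSpace n => φ p.1 *
      (Complex.exp (-((inner ℝ p.2 (cmul n z p.1) : ℝ) : ℂ) * Complex.I) * ψ p.2))
      (volume.prod volume) := by
    refine (φ.integrable.mul_prod ψ.integrable).mono ?_ (Eventually.of_forall fun p => ?_)
    · have : Continuous (fun p : RSpace n × RSpace n => φ p.1 *
        (Complex.exp (-((inner ℝ p.2 (cmul n z p.1) : ℝ) : ℂ) * Complex.I) * ψ p.2)) := by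
        fun_prop
      exact this.aestronglyMeasurable
    · rw [norm_mul, norm_mul, norm_mul, ← Complex.ofReal_neg, Complex.norm_exp_ofReal_mul_I, one_mul]
  simp_rw [schwartzFourier_apply, ← integral_const_mul]
  rw [integral_integral_swap hint]
  refine integral_congr_ae (Eventually.of_forall fun y =>
    integral_congr_ae (Eventually.of_forall fun x => ?_))
  have : inner ℝ y (cmul n z x) = inner ℝ x (cmul n ((starRingEnd ℂ) z) y) := by
    rw [real_inner_comm, inner_cmul_left]
  simp only [this]
  ring

variable [NeZero n]

theorem aestronglyMeasurable_lineFourier (φ : SchwartzMap (RSpace n) ℂ) :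
    AEStronglyMeasurable (lineFourier φ) :=
  aestronglyMeasurable_of_continuousOn_compl_zero (continuousOn_lineFourier φ)

theorem ae_ne_zero : ∀ᵐ x : RSpace n, x ≠ 0 := Measure.ae_ne volume 0

/-- Joint integrability on `ℝ^{2n} × ℂ`, needed to integrate along all complex lines. -/
theorem integrable_mul_schwartzFourier_cmul (hn : 2 ≤ n) {h : RSpace n → ℂ}
    (hm : AEStronglyMeasurable h) {C : ℝ} (hC : 0 ≤ C)
    (hh : ∀ x, ‖h x‖ ≤ C * ((1 + ‖x‖) ^ (2 * n + 1))⁻¹) (φ : SchwartzMap (RSpace n) ℂ) :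
    Integrable (fun p : RSpace n × ℂ => h p.1 * schwartzFourier (RSpace n) φ (cmul n p.2 p.1))
      (volume.prod volume) := by
  obtain ⟨D, hD, hφ⟩ := exists_norm_schwartz_le (schwartzFourier (RSpace n) φ) 3
  have hmaj : Integrable (fun p : RSpace n × ℂ =>
      C * ((1 + ‖p.1‖) ^ (2 * n + 1))⁻¹ * (D * ((1 + ‖p.2‖ * ‖p.1‖) ^ 3)⁻¹))
      (volume.prod volume) := by
    have hcont : Continuous (fun p : RSpace n × ℂ =>
      C * ((1 + ‖p.1‖) ^ (2 * n + 1))⁻¹ * (D * ((1 + ‖p.2‖ * ‖p.1‖) ^ 3)⁻¹)) := by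
      refine (continuous_const.mul (Continuous.inv₀ (by fun_prop) fun p => by positivity)).mul
        (continuous_const.mul (Continuous.inv₀ (by fun_prop) fun p => by positivity))
    rw [integrable_prod_iff hcont.aestronglyMeasurable]
    constructor
    · filter_upwards [ae_ne_zero] with x hx
      exact ((integrable_inv_one_add_norm_mul_pow (norm_pos_iff.2 hx)).const_mul D).const_mul _
    -- The z-integral contributes |x|^(-2), which is locally integrable because 2 < 2n.
    · have h1 := integrable_inv_norm_pow_mul (E := RSpace n) (k := 2)
        (by rw [finrank_rSpace]; omega)
      rw [finrank_rSpace] at h1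
      refine (h1.const_mul (C * D * ∫ z : ℂ, ((1 + ‖z‖) ^ 3)⁻¹)).congr ?_
      filter_upwards [ae_ne_zero] with x hx
      have : ∀ z : ℂ, ‖C * ((1 + ‖x‖) ^ (2 * n + 1))⁻¹ * (D * ((1 + ‖z‖ * ‖x‖) ^ 3)⁻¹)‖ =
          C * ((1 + ‖x‖) ^ (2 * n + 1))⁻¹ * (D * ((1 + ‖z‖ * ‖x‖) ^ 3)⁻¹) := fun z =>
        Real.norm_of_nonneg (by positivity)
      simp_rw [this]
      rw [integral_const_mul, integral_const_mul,
        integral_inv_one_add_norm_mul_pow (norm_pos_iff.2 hx)]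
      ring
  refine hmaj.mono' ?_ (Eventually.of_forall fun p => ?_)
  · have : Continuous fun p : RSpace n × ℂ =>
      schwartzFourier (RSpace n) φ (cmul n p.2 p.1) := by fun_prop
    exact hm.comp_fst.mul this.aestronglyMeasurable
  · rw [norm_mul]
    have := hφ (cmul n p.2 p.1)
    rw [norm_cmul] at this
    exact mul_le_mul (hh _) this (norm_nonneg _) (by positivity)

/-- For a fixed z the two sides differ by z ↔ z̄; integrating over ℂ removes the difference, since
conjugation preserves its measure. -/
theorem integral_mul_lineFourier (hn : 2 ≤ n) (φ ψ : SchwartzMap (RSpace n) ℂ) :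
    ∫ x, φ x * lineFourier ψ x = ∫ y, ψ y * lineFourier φ y := by
  obtain ⟨C, hC, hφ⟩ := exists_norm_schwartz_le φ (2 * n + 1)
  obtain ⟨D, hD, hψ⟩ := exists_norm_schwartz_le ψ (2 * n + 1)
  have h1 := integrable_mul_schwartzFourier_cmul hn φ.continuous.aestronglyMeasurable hC hφ ψ
  have h2 := integrable_mul_schwartzFourier_cmul hn ψ.continuous.aestronglyMeasurable hD hψ φ
  simp_rw [lineFourier, ← integral_const_mul]
  refine (integral_integral_swap h1).trans (Eq.trans ?_ (integral_integral_swap h2).symm)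
  simp_rw [integral_mul_schwartzFourier_cmul φ ψ]
  exact Complex.conjLIE.measurePreserving.integral_comp
    Complex.conjLIE.toHomeomorph.measurableEmbedding
    (fun z : ℂ => ∫ y, ψ y * schwartzFourier (RSpace n) φ (cmul n z y))

end LineFourier

/-! ### From Schwartz functions to continuous functions of compact support -/

section Approximation

variable {n : ℕ}

theorem exists_schwartz_approx {E : Type*} [NormedAddCommGroup E] [NormedSpace ℝ E]
    [FiniteDimensional ℝ E] {h : E → ℂ} (hc : Continuous h) {R : ℝ}
    (hR : ∀ y, R < ‖y‖ → h y = 0) {ε : ℝ} (hε : 0 < ε) :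
    ∃ ψ : SchwartzMap E ℂ, (∀ y, ‖ψ y - h y‖ ≤ ε) ∧ ∀ y, R + 1 < ‖y‖ → ψ y = 0 := by
  have hsupp : HasCompactSupport h := HasCompactSupport.intro (isCompact_closedBall (0 : E) R)
    fun y hy => hR y (by simpa using hy)
  obtain ⟨δ, hδ, hu⟩ := Metric.uniformContinuous_iff.1
    (hsupp.uniformContinuous_of_continuous hc) ε hε
  obtain ⟨g, hg, hgd⟩ := hc.exists_contDiff_dist_le_of_forall_mem_ball_dist_le
    (lt_min hδ one_pos)
  have hg0 : ∀ y, R + 1 < ‖y‖ → g y = 0 := by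
    intro y hy
    have h0 : h y = 0 := hR y (by linarith)
    -- Tolerance 0: h vanishes on the mollification ball, of radius at most 1, so g vanishes at its
    -- centre.
    have := hgd y 0 fun x hx => by
      have hx1 : dist x y < 1 := lt_of_lt_of_le hx (min_le_right _ _)
      rw [dist_eq_norm] at hx1
      have := norm_le_norm_add_norm_sub' y x
      rw [norm_sub_rev] at this
      rw [h0, hR x (by linarith), dist_self]
    rw [h0, dist_zero_right] at this
    exact norm_le_zero_iff.1 this
  have hgs : HasCompactSupport g := HasCompactSupport.intro (isCompact_closedBall (0 : E) (R + 1))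
    fun y hy => hg0 y (by simpa using hy)
  refine ⟨hgs.toSchwartzMap hg, fun y => ?_, fun y hy => hg0 y hy⟩
  have := hgd y ε fun x hx => (hu (lt_of_lt_of_le hx (min_le_left _ _))).le
  rwa [dist_eq_norm] at this

theorem volume_closedBall_eq_of_finrank_eq {E : Type*} [NormedAddCommGroup E]
    [InnerProductSpace ℝ E] [FiniteDimensional ℝ E] [MeasurableSpace E] [BorelSpace E] {d : ℕ}
    (hd : Module.finrank ℝ E = d) (R : ℝ) :
    volume (Metric.closedBall (0 : E) R) =
      volume (Metric.closedBall (0 : EuclideanSpace ℝ (Fin d)) R) := by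
  subst hd
  have e := (stdOrthonormalBasis ℝ E).repr
  rw [← e.measurePreserving.measure_preimage measurableSet_closedBall.nullMeasurableSet,
    e.preimage_closedBall, map_zero]

theorem integrable_hyperplane {h : RSpace n → ℂ} (hc : Continuous h) {R : ℝ}
    (hR : ∀ y, R < ‖y‖ → h y = 0) (x : RSpace n) :
    Integrable fun y : complexHyperplane x => h y := by
  refine (hc.comp continuous_subtype_val).integrable_of_hasCompactSupport
    (HasCompactSupport.intro (isCompact_closedBall (0 : complexHyperplane x) R) fun y hy =>
      hR y (by simpa using hy))

/-- A bounded function supported in a ball has a bounded integral over all complex hyperplanes,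
uniformly. -/
theorem norm_hyperplaneIntegral_le {h : RSpace n → ℂ} {R ε : ℝ}
    (hR : ∀ y, R < ‖y‖ → h y = 0) (hε : ∀ y, ‖h y‖ ≤ ε) {x : RSpace n} (hx : x ≠ 0) :
    ‖hyperplaneIntegral h x‖ ≤
      ε * volume.real (Metric.closedBall (0 : EuclideanSpace ℝ (Fin (2 * n - 2))) R) := by
  have h1 : hyperplaneIntegral h x =
      ∫ y in Metric.closedBall (0 : complexHyperplane x) R, h y :=
    (setIntegral_eq_integral_of_forall_compl_eq_zero (μ := volume)
      (s := Metric.closedBall (0 : complexHyperplane x) R)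
      (f := fun y : complexHyperplane x => h y) fun y hy => hR y (by simpa using hy)).symm
  rw [h1, measureReal_def, ← volume_closedBall_eq_of_finrank_eq (finrank_complexHyperplane hx) R]
  exact norm_setIntegral_le_of_norm_le_const measure_closedBall_lt_top fun y _ => hε y

theorem norm_hyperplaneIntegral_sub_le {g h : RSpace n → ℂ} (hgc : Continuous g)
    (hc : Continuous h) {R ε : ℝ} (hgR : ∀ y, R < ‖y‖ → g y = 0) (hR : ∀ y, R < ‖y‖ → h y = 0)
    (hε : ∀ y, ‖g y - h y‖ ≤ ε) {x : RSpace n} (hx : x ≠ 0) :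
    ‖hyperplaneIntegral g x - hyperplaneIntegral h x‖ ≤
      ε * volume.real (Metric.closedBall (0 : EuclideanSpace ℝ (Fin (2 * n - 2))) R) := by
  have : hyperplaneIntegral g x - hyperplaneIntegral h x =
      hyperplaneIntegral (fun y => g y - h y) x :=
    (integral_sub (integrable_hyperplane hgc hgR x) (integrable_hyperplane hc hR x)).symm
  rw [this]
  exact norm_hyperplaneIntegral_le (fun y hy => by rw [hgR y hy, hR y hy, sub_zero]) hε hx

/-- The domain H_x moves with x, but up to a power of |x| the integral is `lineFourier`, taken over
the fixed domain ℂ. -/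
theorem continuousOn_hyperplaneIntegral_schwartz (φ : SchwartzMap (RSpace n) ℂ) :
    ContinuousOn (hyperplaneIntegral φ) {0}ᶜ := by
  have h : ContinuousOn (fun x => (((2 * Real.pi) ^ 2)⁻¹ * ‖x‖ ^ 2 : ℝ) * lineFourier φ x) {0}ᶜ :=
    ContinuousOn.mul (by fun_prop) (continuousOn_lineFourier φ)
  refine h.congr fun x (hx : x ≠ 0) => ?_
  have hx' : ‖x‖ ≠ 0 := norm_ne_zero_iff.2 hx
  simp only
  rw [lineFourier_eq φ hx, ← mul_assoc, ← Complex.ofReal_mul]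
  have : ((2 * Real.pi) ^ 2)⁻¹ * ‖x‖ ^ 2 * ((2 * Real.pi) ^ 2 * (‖x‖ ^ 2)⁻¹) = 1 := by
    field_simp
  rw [this, Complex.ofReal_one, one_mul]

/-- Smooth approximants, uniformly close and with uniformly bounded support. -/
theorem exists_schwartz_seq {E : Type*} [NormedAddCommGroup E] [NormedSpace ℝ E]
    [FiniteDimensional ℝ E] {h : E → ℂ} (hc : Continuous h) {R : ℝ}
    (hR : ∀ y, R < ‖y‖ → h y = 0) :
    ∃ ψ : ℕ → SchwartzMap E ℂ, (∀ j y, ‖ψ j y - h y‖ ≤ 1 / ((j : ℝ) + 1)) ∧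
      ∀ j y, R + 1 < ‖y‖ → ψ j y = 0 := by
  choose ψ h1 h2 using fun j : ℕ =>
    exists_schwartz_approx hc hR (ε := 1 / ((j : ℝ) + 1)) Nat.one_div_pos_of_nat
  exact ⟨ψ, h1, h2⟩

/-- All supports lie in one ball, whose section by H_x has the same volume for every x ≠ 0. -/
theorem tendsto_hyperplaneIntegral {h : RSpace n → ℂ} (hc : Continuous h) {R : ℝ}
    (hR : ∀ y, R < ‖y‖ → h y = 0) {ψ : ℕ → SchwartzMap (RSpace n) ℂ}
    (h1 : ∀ j y, ‖ψ j y - h y‖ ≤ 1 / ((j : ℝ) + 1)) (h2 : ∀ j y, R + 1 < ‖y‖ → ψ j y = 0) :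
    TendstoUniformlyOn (fun j x => hyperplaneIntegral (ψ j) x) (hyperplaneIntegral h) atTop
      {0}ᶜ := by
  rw [Metric.tendstoUniformlyOn_iff]
  intro ε hε
  set V := volume.real (Metric.closedBall (0 : EuclideanSpace ℝ (Fin (2 * n - 2))) (R + 1))
  have hlim : Tendsto (fun j : ℕ => 1 / ((j : ℝ) + 1) * V) atTop (𝓝 0) := by
    simpa using tendsto_one_div_add_atTop_nhds_zero_nat.mul_const V
  filter_upwards [hlim.eventually (gt_mem_nhds hε)] with j hj x hx
  rw [dist_comm, dist_eq_norm]
  exact (norm_hyperplaneIntegral_sub_le (ψ j).continuous hc (h2 j)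
    (fun y hy => hR y (by linarith)) (h1 j) hx).trans_lt hj

theorem continuousOn_hyperplaneIntegral {h : RSpace n → ℂ} (hc : Continuous h) {R : ℝ}
    (hR : ∀ y, R < ‖y‖ → h y = 0) : ContinuousOn (hyperplaneIntegral h) {0}ᶜ := by
  obtain ⟨ψ, h1, h2⟩ := exists_schwartz_seq hc hR
  exact (tendsto_hyperplaneIntegral hc hR h1 h2).continuousOn
    (Frequently.of_forall fun j => continuousOn_hyperplaneIntegral_schwartz (ψ j))

/-- The limit of the symmetry identity along the approximants; on both sides |x|^(-2) times a
decaying factor dominates. -/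
theorem integral_hyperplaneIntegral_eq [NeZero n] (hn : 2 ≤ n) {h : RSpace n → ℂ}
    (hc : Continuous h) {R : ℝ} (hR : ∀ y, R < ‖y‖ → h y = 0) (φ : SchwartzMap (RSpace n) ℂ) :
    ∫ x, φ x * (((2 * Real.pi) ^ 2 * (‖x‖ ^ 2)⁻¹ : ℝ) * hyperplaneIntegral h x) =
      ∫ y, h y * lineFourier φ y := by
  obtain ⟨ψ, h1, h2⟩ := exists_schwartz_seq hc hR
  obtain ⟨M, hM⟩ : ∃ M, ∀ y, ‖h y‖ ≤ M :=
    hc.bounded_above_of_compact_support (HasCompactSupport.intro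
      (isCompact_closedBall (0 : RSpace n) R) fun y hy => hR y (by simpa using hy))
  have hψM : ∀ j y, ‖ψ j y‖ ≤ M + 1 := fun j y => by
    have a := norm_le_norm_add_norm_sub' (ψ j y) (h y)
    have b : 1 / ((j : ℝ) + 1) ≤ 1 := by
      rw [div_le_one (by positivity)]
      linarith [(Nat.cast_nonneg j : (0 : ℝ) ≤ j)]
    linarith [h1 j y, hM y]
  have hM0 : 0 ≤ M + 1 := (norm_nonneg _).trans (hψM 0 0)
  have hlimψ : ∀ y, Tendsto (fun j => ψ j y) atTop (𝓝 (h y)) := fun y =>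
    tendsto_iff_norm_sub_tendsto_zero.2 (squeeze_zero (fun j => norm_nonneg _) (fun j => h1 j y)
      tendsto_one_div_add_atTop_nhds_zero_nat)
  have hk : 2 < Module.finrank ℝ (RSpace n) := by rw [finrank_rSpace]; omega
  have hleft : Tendsto (fun j => ∫ x, φ x * lineFourier (ψ j) x) atTop
      (𝓝 (∫ x, φ x * (((2 * Real.pi) ^ 2 * (‖x‖ ^ 2)⁻¹ : ℝ) * hyperplaneIntegral h x))) := by
    set V := volume.real (Metric.closedBall (0 : EuclideanSpace ℝ (Fin (2 * n - 2))) (R + 1))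
    obtain ⟨D, hD, hφ⟩ := exists_norm_schwartz_le φ (Module.finrank ℝ (RSpace n) + 1)
    refine tendsto_integral_of_dominated_convergence (fun x =>
      (D * (2 * Real.pi) ^ 2 * ((M + 1) * V)) *
        ((‖x‖ ^ 2)⁻¹ * ((1 + ‖x‖) ^ (Module.finrank ℝ (RSpace n) + 1))⁻¹))
      (fun j => φ.continuous.aestronglyMeasurable.mul (aestronglyMeasurable_lineFourier _))
      ((integrable_inv_norm_pow_mul hk).const_mul _) (fun j => ?_) ?_
    · filter_upwards [ae_ne_zero] with x hx
      rw [norm_mul, lineFourier_eq _ hx, norm_mul, Complex.norm_real,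
        Real.norm_of_nonneg (by positivity)]
      calc _ ≤ (D * ((1 + ‖x‖) ^ (Module.finrank ℝ (RSpace n) + 1))⁻¹) *
            ((2 * Real.pi) ^ 2 * (‖x‖ ^ 2)⁻¹ * ((M + 1) * V)) := by
            gcongr
            · exact hφ x
            · exact norm_hyperplaneIntegral_le (h2 j) (hψM j) hx
        _ = _ := by ring
    · filter_upwards [ae_ne_zero] with x hx
      simp_rw [lineFourier_eq _ hx]
      exact (((tendsto_hyperplaneIntegral hc hR h1 h2).tendsto_at hx).const_mul _).const_mul _
  have hright : Tendsto (fun j => ∫ y, ψ j y * lineFourier φ y) atTop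
      (𝓝 (∫ y, h y * lineFourier φ y)) := by
    obtain ⟨C, hC, hP⟩ := norm_lineFourier_le φ
    set d := Module.finrank ℝ (RSpace n)
    refine tendsto_integral_of_dominated_convergence (fun y =>
      ((M + 1) * (2 + |R|) ^ (d + 1) * C) * ((‖y‖ ^ 2)⁻¹ * ((1 + ‖y‖) ^ (d + 1))⁻¹))
      (fun j => (ψ j).continuous.aestronglyMeasurable.mul (aestronglyMeasurable_lineFourier _))
      ((integrable_inv_norm_pow_mul hk).const_mul _) (fun j => ?_) ?_
    · filter_upwards [ae_ne_zero] with y hy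
      rw [norm_mul]
      have hb : ‖ψ j y‖ ≤ (M + 1) * (2 + |R|) ^ (d + 1) * ((1 + ‖y‖) ^ (d + 1))⁻¹ := by
        by_cases hy2 : R + 1 < ‖y‖
        · rw [h2 j y hy2, norm_zero]
          positivity
        · rw [← div_eq_mul_inv, le_div_iff₀ (by positivity)]
          exact mul_le_mul (hψM j y) (pow_le_pow_left₀ (by positivity)
            (by linarith [le_abs_self R]) _) (by positivity) hM0
      calc _ ≤ _ := mul_le_mul hb (hP y hy) (norm_nonneg _) (by positivity)
        _ = _ := by ring
    · exact Eventually.of_forall fun y => (hlimψ y).mul_const _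
  refine tendsto_nhds_unique hleft (hright.congr fun j => ?_)
  exact (integral_mul_lineFourier hn φ (ψ j)).symm

end Approximation

/-! ### Star bodies and their gauge -/

section StarBody

variable {E : Type*} [NormedAddCommGroup E] [NormedSpace ℝ E] {K : Set E}

theorem IsStarBody.zero_mem (hK : IsStarBody K) : (0 : E) ∈ K :=
  interior_subset hK.zero_mem_interior

/-- Otherwise the interior of t and the complement of its closure would separate s. -/
theorem isPreconnected_inter_frontier {X : Type*} [TopologicalSpace X] {s t : Set X}
    (hs : IsPreconnected s) (h1 : (s ∩ t).Nonempty) (h2 : (s ∩ tᶜ).Nonempty) :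
    (s ∩ frontier t).Nonempty := by
  by_contra hne
  have hd : ∀ x ∈ s, x ∈ closure t → x ∈ interior t := fun x hx hc => by
    by_contra hi
    exact hne ⟨x, hx, hc, hi⟩
  obtain ⟨x, hx, hxt⟩ := h1
  obtain ⟨y, hy, hyt⟩ := h2
  obtain ⟨w, -, hw1, hw2⟩ := hs (interior t) (closure t)ᶜ isOpen_interior
    isClosed_closure.isOpen_compl
    (fun w hw => (em (w ∈ closure t)).imp (hd w hw) id) ⟨x, hx, hd x hx (subset_closure hxt)⟩
    ⟨y, hy, fun hc => hyt (interior_subset (hd y hy hc))⟩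
  exact hw2 (subset_closure (interior_subset hw1))

/-- A segment on a ray with one end in `K` and the other outside meets the frontier of `K`. -/
theorem exists_smul_mem_frontier {a b : ℝ} (hab : a ≤ b) {x : E}
    (h : (a • x ∈ K ∧ b • x ∉ K) ∨ (a • x ∉ K ∧ b • x ∈ K)) :
    ∃ t ∈ Icc a b, t • x ∈ frontier K := by
  have hconn : IsPreconnected ((fun t : ℝ => t • x) '' Icc a b) :=
    isPreconnected_Icc.image _ (by fun_prop)
  have ha : a • x ∈ (fun t : ℝ => t • x) '' Icc a b := ⟨a, left_mem_Icc.2 hab, rfl⟩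
  have hb : b • x ∈ (fun t : ℝ => t • x) '' Icc a b := ⟨b, right_mem_Icc.2 hab, rfl⟩
  obtain ⟨_, ⟨t, ht, rfl⟩, hf⟩ : ((fun t : ℝ => t • x) '' Icc a b ∩ frontier K).Nonempty := by
    rcases h with ⟨h1, h2⟩ | ⟨h1, h2⟩
    · exact isPreconnected_inter_frontier hconn ⟨_, ha, h1⟩ ⟨_, hb, h2⟩
    · exact isPreconnected_inter_frontier hconn ⟨_, hb, h2⟩ ⟨_, ha, h1⟩
  exact ⟨t, ht, hf⟩

theorem IsStarBody.zero_notMem_frontier (hK : IsStarBody K) : (0 : E) ∉ frontier K :=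
  fun h => h.2 hK.zero_mem_interior

theorem IsStarBody.exists_norm_le (hK : IsStarBody K) : ∃ R, 0 < R ∧ ∀ x ∈ K, ‖x‖ ≤ R := by
  obtain ⟨R, hR⟩ := hK.isCompact.isBounded.exists_norm_le
  exact ⟨max R 1, by positivity, fun x hx => (hR x hx).trans (le_max_left _ _)⟩

/-- A star body is star-shaped with respect to the origin. -/
theorem IsStarBody.smul_mem (hK : IsStarBody K) {x : E} (hx : x ∈ K) {s : ℝ} (hs : s ∈ Icc 0 1) :
    s • x ∈ K := by
  by_contra hsx
  have hx0 : x ≠ 0 := by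
    rintro rfl
    rw [smul_zero] at hsx
    exact hsx hx
  have hxn : 0 < ‖x‖ := norm_pos_iff.2 hx0
  obtain ⟨R, hR, hKR⟩ := hK.exists_norm_le
  have hfar : ∀ T : ℝ, R / ‖x‖ < |T| → T • x ∉ K := fun T hT hmem => by
    have := hKR _ hmem
    rw [norm_smul, Real.norm_eq_abs] at this
    rw [div_lt_iff₀ hxn] at hT
    linarith
  set T := 1 + R / ‖x‖
  have hq : 0 < R / ‖x‖ := by positivity
  have hT : 1 < T := by simp only [T]; linarith
  have hTabs : R / ‖x‖ < |T| := by rw [abs_of_pos (by linarith)]; simp only [T]; linarith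
  -- If sx lay outside K, the line would meet the frontier at parameters c < 0 < a < s ≤ 1 ≤ b:
  -- three points instead of two.
  obtain ⟨a, ha, haf⟩ := exists_smul_mem_frontier hs.1 (x := x)
    (Or.inl ⟨by simpa using hK.zero_mem, hsx⟩)
  obtain ⟨b, hb, hbf⟩ := exists_smul_mem_frontier hT.le (x := x)
    (Or.inl ⟨by simpa using hx, hfar T hTabs⟩)
  obtain ⟨c, hc, hcf⟩ := exists_smul_mem_frontier (by linarith : -T ≤ 0) (x := x)
    (Or.inr ⟨hfar (-T) (by rwa [abs_neg]), by simpa using hK.zero_mem⟩)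
  have hne : ∀ t : ℝ, t • x ∈ frontier K → t ≠ 0 := by
    rintro t ht rfl
    rw [zero_smul] at ht
    exact hK.zero_notMem_frontier ht
  have has : a ≠ s := by
    rintro rfl
    exact hsx (hK.isCompact.isClosed.frontier_subset haf)
  have hca : c < a := lt_of_lt_of_le (lt_of_le_of_ne hc.2 (hne c hcf)) ha.1
  have hab : a < b := lt_of_lt_of_le (lt_of_lt_of_le (lt_of_le_of_ne ha.2 has) hs.2) hb.1
  have hinj : ∀ p q : ℝ, p • x = q • x → p = q := fun p q h => smul_left_injective ℝ hx0 h
  have hmem : ∀ t : ℝ, t • x ∈ frontier K → t • x ∈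
      (((Submodule.span ℝ {x} : Submodule ℝ E) : Set E) ∩ (frontier K \ {0})) := fun t ht =>
    ⟨Submodule.smul_mem _ _ (Submodule.mem_span_singleton_self x), ht, fun h0 =>
      hne t ht ((smul_eq_zero_iff_left hx0).1 h0)⟩
  have h3 : ({a • x, b • x, c • x} : Set E).encard = 3 := by
    rw [Set.encard_eq_three]
    exact ⟨_, _, _, fun h => hab.ne (hinj _ _ h), fun h => hca.ne' (hinj _ _ h),
      fun h => (hca.trans hab).ne' (hinj _ _ h), rfl⟩
  have hle := Set.encard_le_encard (s := ({a • x, b • x, c • x} : Set E))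
    (t := ((Submodule.span ℝ {x} : Submodule ℝ E) : Set E) ∩ (frontier K \ {0})) (by
      rintro y (rfl | rfl | rfl)
      · exact hmem a haf
      · exact hmem b hbf
      · exact hmem c hcf)
  rw [h3, hK.encard_line x hx0] at hle
  exact absurd hle (by decide)

theorem IsStarBody.absorbent (hK : IsStarBody K) : Absorbent ℝ K :=
  absorbent_nhds_zero (mem_interior_iff_mem_nhds.1 hK.zero_mem_interior)

theorem IsStarBody.mem_of_gauge_lt_one (hK : IsStarBody K) {x : E} (hx : gauge K x < 1) :
    x ∈ K := by
  obtain ⟨b, hb0, hb1, y, hy, rfl⟩ := exists_lt_of_gauge_lt hK.absorbent hx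
  exact hK.smul_mem hy ⟨hb0.le, hb1.le⟩

/-- A compact K has a point of largest norm, here below 1. The resulting R keeps 1 - r² away from 0
in every radial integral. -/
theorem IsStarBody.exists_radius (hK : IsStarBody K) (hball : K ⊆ Metric.ball 0 1) :
    ∃ R, 0 < R ∧ R < 1 ∧ ∀ x, ‖x‖ ≤ R * gauge K x := by
  obtain ⟨y, hy, hmax⟩ := hK.isCompact.exists_isMaxOn ⟨0, hK.zero_mem⟩ continuous_norm.continuousOn
  have hy1 : ‖y‖ < 1 := by simpa using hball hy
  -- The value 1/2 only serves to make the radius visibly positive.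
  refine ⟨max ‖y‖ (1 / 2), by positivity, max_lt hy1 (by norm_num), fun x => ?_⟩
  have h := le_gauge_of_subset_closedBall (x := x) hK.absorbent
    (by positivity : 0 ≤ max ‖y‖ (1 / 2)) fun z hz => by
      rw [mem_closedBall_zero_iff]
      exact (hmax hz).trans (le_max_left _ _)
  rwa [div_le_iff₀' (by positivity)] at h

end StarBody

/-! ### The section kernel: homogeneity, bounds and radial form -/

section Kernel

variable {n : ℕ} {K : Set (RSpace n)}

theorem gauge_cmul (hrot : IsRotationInvariant K) (z : ℂ) (x : RSpace n) :
    gauge K (cmul n z x) = ‖z‖ * gauge K x := by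
  obtain ⟨θ, hθ, hz⟩ : ∃ θ ∈ Icc (0 : ℝ) (2 * Real.pi), Complex.exp (θ * Complex.I) * ‖z‖ = z := by
    rcases le_or_gt 0 z.arg with h | h
    · exact ⟨z.arg, ⟨h, by linarith [Complex.arg_le_pi z, Real.pi_pos]⟩, by
        rw [mul_comm, Complex.norm_mul_exp_arg_mul_I]⟩
    -- Invariance is given for angles in [0, 2π] only, so a negative argument is shifted.
    · refine ⟨z.arg + 2 * Real.pi, ⟨by linarith [Complex.neg_pi_lt_arg z], by linarith⟩, ?_⟩
      rw [Complex.ofReal_add, add_mul, Complex.exp_add, Complex.ofReal_mul, Complex.ofReal_ofNat,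
        Complex.exp_two_pi_mul_I, mul_one, mul_comm, Complex.norm_mul_exp_arg_mul_I]
  have h1 : cmul n z x = rotate θ ((‖z‖ : ℝ) • x) := by
    rw [rotate_eq_cmul, ← cmul_ofReal, ← cmul_mul, hz]
  rw [h1, ← hrot θ hθ, gauge_smul_of_nonneg (norm_nonneg z), smul_eq_mul]

theorem zpow_neg_two_mul_add_two (hn : 2 ≤ n) (r : ℝ) :
    r ^ (-2 * (n : ℤ) + 2) = (r ^ (2 * n - 2))⁻¹ := by
  rw [← zpow_natCast, ← zpow_neg]
  congr 1
  push_cast [Nat.cast_sub (by omega : 2 ≤ 2 * n)]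
  ring

theorem sectionKernel_eq (hn : 2 ≤ n) (x : RSpace n) :
    sectionKernel K x = (‖x‖ ^ (2 * n - 2))⁻¹ *
      ∫ r in (0 : ℝ)..(‖x‖ / gauge K x), r ^ (2 * n - 3) / (1 - r ^ 2) ^ n := by
  rw [sectionKernel, zpow_neg_two_mul_add_two hn]

/-- The ratio of |x| to the gauge is unchanged by z, so only the prefactor scales. -/
theorem sectionKernel_cmul (hn : 2 ≤ n) (hrot : IsRotationInvariant K) {z : ℂ} (hz : z ≠ 0)
    (x : RSpace n) :
    sectionKernel K (cmul n z x) = (‖z‖ ^ (2 * n - 2))⁻¹ * sectionKernel K x := by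
  rw [sectionKernel_eq hn, sectionKernel_eq hn, gauge_cmul hrot, norm_cmul,
    mul_div_mul_left _ _ (norm_ne_zero_iff.2 hz), mul_pow, mul_inv, mul_assoc]

theorem continuousOn_radialDensity (n : ℕ) {R : ℝ} (hR : R < 1) :
    ContinuousOn (fun r : ℝ => r ^ (2 * n - 3) / (1 - r ^ 2) ^ n) (Icc 0 R) := by
  refine ContinuousOn.div (by fun_prop) (by fun_prop) fun r hr => pow_ne_zero _ ?_
  have : r ^ 2 < 1 := by nlinarith [hr.1, hr.2]
  linarith

theorem div_gauge_mem_Icc {R : ℝ} (hR : 0 < R) (hg : ∀ x, ‖x‖ ≤ R * gauge K x) (x : RSpace n) :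
    ‖x‖ / gauge K x ∈ Icc 0 R :=
  ⟨div_nonneg (norm_nonneg _) (gauge_nonneg _),
    div_le_of_le_mul₀ (gauge_nonneg _) hR.le (hg x)⟩

theorem gauge_pos_of_ne_zero {R : ℝ} (hR : 0 < R) (hg : ∀ x, ‖x‖ ≤ R * gauge K x) {x : RSpace n}
    (hx : x ≠ 0) : 0 < gauge K x :=
  pos_of_mul_pos_right (lt_of_lt_of_le (norm_pos_iff.2 hx) (hg x)) hR.le

theorem radialDensity_nonneg (n : ℕ) {r : ℝ} (h0 : 0 ≤ r) (h1 : r < 1) :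
    0 ≤ r ^ (2 * n - 3) / (1 - r ^ 2) ^ n := by
  have : 0 ≤ 1 - r ^ 2 := by nlinarith
  positivity

theorem sectionKernel_nonneg (hn : 2 ≤ n) {R : ℝ} (hR : 0 < R) (hR1 : R < 1)
    (hg : ∀ x, ‖x‖ ≤ R * gauge K x) (x : RSpace n) : 0 ≤ sectionKernel K x := by
  have h := div_gauge_mem_Icc hR hg x
  rw [sectionKernel_eq hn]
  refine mul_nonneg (by positivity) (intervalIntegral.integral_nonneg h.1 fun r hr => ?_)
  exact radialDensity_nonneg n hr.1 (by linarith [hr.2, h.2])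

theorem continuousOn_sectionKernel (hn : 2 ≤ n) (hcont : Continuous (gauge K)) {R : ℝ}
    (hR : 0 < R) (hR1 : R < 1) (hg : ∀ x, ‖x‖ ≤ R * gauge K x) :
    ContinuousOn (sectionKernel K) {0}ᶜ := by
  have hG : ContinuousOn (fun u => ∫ r in (0 : ℝ)..u, r ^ (2 * n - 3) / (1 - r ^ 2) ^ n)
      (Icc 0 R) := by
    have := intervalIntegral.continuousOn_primitive_interval (μ := volume) (a := 0) (b := R)
      (f := fun r : ℝ => r ^ (2 * n - 3) / (1 - r ^ 2) ^ n) (by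
        rw [uIcc_of_le hR.le]
        exact (continuousOn_radialDensity n hR1).integrableOn_Icc)
    rwa [uIcc_of_le hR.le] at this
  have hu : ContinuousOn (fun x => ‖x‖ / gauge K x) {0}ᶜ :=
    continuous_norm.continuousOn.div hcont.continuousOn fun x hx =>
      (gauge_pos_of_ne_zero hR hg hx).ne'
  have h1 : ContinuousOn (fun x : RSpace n => (‖x‖ ^ (2 * n - 2))⁻¹) {0}ᶜ :=
    ContinuousOn.inv₀ (by fun_prop) fun x hx => pow_ne_zero _ (norm_ne_zero_iff.2 hx)
  exact (h1.mul (hG.comp hu fun x _ => div_gauge_mem_Icc hR hg x)).congr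
    fun x _ => sectionKernel_eq hn x

theorem exists_sectionKernel_le (hn : 2 ≤ n) {R : ℝ}
    (hR : 0 < R) (hR1 : R < 1) (hg : ∀ x, ‖x‖ ≤ R * gauge K x) :
    ∃ C, 0 ≤ C ∧ ∀ x, sectionKernel K x ≤ C * (‖x‖ ^ (2 * n - 2))⁻¹ := by
  have hint := (continuousOn_radialDensity n hR1).intervalIntegrable_of_Icc (μ := volume) hR.le
  refine ⟨∫ r in (0 : ℝ)..R, r ^ (2 * n - 3) / (1 - r ^ 2) ^ n,
    intervalIntegral.integral_nonneg hR.le fun r hr =>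
      radialDensity_nonneg n hr.1 (by linarith [hr.2]), fun x => ?_⟩
  have h := div_gauge_mem_Icc hR hg x
  rw [sectionKernel_eq hn, mul_comm]
  gcongr
  refine intervalIntegral.integral_mono_interval le_rfl h.1 h.2 ?_ hint
  refine (ae_restrict_iff' measurableSet_Ioc).2 (Eventually.of_forall fun r hr => ?_)
  exact radialDensity_nonneg n hr.1.le (by linarith [hr.2])

/-- The hyperbolic volume density of a body, up to the factor `8 ^ (n - 1)`. -/
def bodyDensity (K : Set (RSpace n)) (x : RSpace n) : ENNReal :=
  K.indicator (fun y => ENNReal.ofReal ((1 - ‖y‖ ^ 2) ^ n)⁻¹) x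

theorem measurable_bodyDensity (hK : IsStarBody K) : Measurable (bodyDensity K) :=
  Measurable.indicator (by fun_prop) hK.isCompact.isClosed.measurableSet

/-- Substitute r = t|x|: the upper limit becomes the inverse gauge of x, and up to that endpoint tx
lies in K exactly below it. -/
theorem ofReal_sectionKernel (hn : 2 ≤ n) (hK : IsStarBody K) {R : ℝ}
    (hR : 0 < R) (hR1 : R < 1) (hg : ∀ x, ‖x‖ ≤ R * gauge K x) {x : RSpace n} (hx : x ≠ 0) :
    ENNReal.ofReal (sectionKernel K x) =
      ∫⁻ t in Ioi (0 : ℝ), ENNReal.ofReal (t ^ (2 * n - 3)) * bodyDensity K (t • x) := by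
  have hxn : 0 < ‖x‖ := norm_pos_iff.2 hx
  have hgx := gauge_pos_of_ne_zero hR hg hx
  set A := (gauge K x)⁻¹ with hA
  have hA0 : 0 < A := inv_pos.2 hgx
  have hAx : A * ‖x‖ ≤ R := by
    have := (div_gauge_mem_Icc hR hg x).2
    rwa [div_eq_inv_mul] at this
  have hsub : sectionKernel K x =
      ∫ t in (0 : ℝ)..A, t ^ (2 * n - 3) * ((1 - (t * ‖x‖) ^ 2) ^ n)⁻¹ := by
    have h := intervalIntegral.integral_comp_mul_right (a := 0) (b := A)
      (fun r : ℝ => r ^ (2 * n - 3) / (1 - r ^ 2) ^ n) hxn.ne'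
    rw [zero_mul, smul_eq_mul] at h
    have h2 : ∫ t in (0 : ℝ)..A, (t * ‖x‖) ^ (2 * n - 3) / (1 - (t * ‖x‖) ^ 2) ^ n =
        ‖x‖ ^ (2 * n - 3) *
          ∫ t in (0 : ℝ)..A, t ^ (2 * n - 3) * ((1 - (t * ‖x‖) ^ 2) ^ n)⁻¹ := by
      rw [← intervalIntegral.integral_const_mul]
      congr 1
      funext t
      rw [mul_pow, div_eq_mul_inv]
      ring
    rw [h2] at h
    have e : 2 * n - 2 = (2 * n - 3) + 1 := by omega
    rw [sectionKernel_eq hn, e, pow_succ, div_eq_inv_mul, mul_inv, mul_assoc, ← hA, ← h,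
      inv_mul_cancel_left₀ (by positivity)]
  have hlt : ∀ t ∈ Icc 0 A, (t * ‖x‖) ^ 2 < 1 := fun t ht => by
    have h1 : t * ‖x‖ ≤ R := (mul_le_mul_of_nonneg_right ht.2 hxn.le).trans hAx
    have h0 : 0 ≤ t * ‖x‖ := mul_nonneg ht.1 hxn.le
    nlinarith
  have hcont : ContinuousOn (fun t : ℝ => t ^ (2 * n - 3) * ((1 - (t * ‖x‖) ^ 2) ^ n)⁻¹)
      (Icc 0 A) := by
    refine ContinuousOn.mul (by fun_prop) (ContinuousOn.inv₀ (by fun_prop) fun t ht => ?_)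
    exact pow_ne_zero _ (by linarith [hlt t ht])
  rw [hsub, intervalIntegral.integral_of_le hA0.le, ofReal_integral_eq_lintegral_ofReal
    (hcont.integrableOn_Icc.mono_set Ioc_subset_Icc_self)
    ((ae_restrict_iff' measurableSet_Ioc).2 (Eventually.of_forall fun t ht => ?_)),
    ← lintegral_indicator measurableSet_Ioc, ← lintegral_indicator measurableSet_Ioi]
  · refine lintegral_congr_ae ?_
    filter_upwards [Measure.ae_ne (volume : Measure ℝ) A] with t htA
    by_cases ht0 : t ∈ Ioi (0 : ℝ)
    · have hgt : gauge K (t • x) = t * gauge K x := gauge_smul_of_nonneg (le_of_lt ht0) x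
      have ht0' : 0 < t := ht0
      rw [indicator_of_mem ht0]
      rcases lt_or_gt_of_ne htA with h | h
      · have hmem : t • x ∈ K := hK.mem_of_gauge_lt_one (by
          rw [hgt]
          calc t * gauge K x < A * gauge K x := by gcongr
            _ = 1 := inv_mul_cancel₀ hgx.ne')
        rw [indicator_of_mem (show t ∈ Ioc 0 A from ⟨ht0, h.le⟩), bodyDensity,
          indicator_of_mem hmem, norm_smul, Real.norm_of_nonneg ht0'.le,
          ENNReal.ofReal_mul (by positivity)]
      · have hmem : t • x ∉ K := fun hm => by
          have h1 := gauge_le_one_of_mem hm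
          rw [hgt] at h1
          have h2 : 1 < t * gauge K x := by
            calc 1 = A * gauge K x := (inv_mul_cancel₀ hgx.ne').symm
              _ < _ := by gcongr
          linarith
        rw [indicator_of_notMem (fun hm : t ∈ Ioc 0 A => absurd hm.2 (not_le.2 h)), bodyDensity,
          indicator_of_notMem hmem, mul_zero]
    · rw [indicator_of_notMem ht0, indicator_of_notMem fun hm : t ∈ Ioc 0 A => ht0 hm.1]
  · have := hlt t ⟨ht.1.le, ht.2⟩
    have h3 : 0 ≤ 1 - (t * ‖x‖) ^ 2 := by linarith
    have := ht.1.le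
    simp only [Pi.zero_apply]
    positivity

end Kernel

/-! ### A radial weight normalised for dilations -/

section RadialBump

/-- A continuous probability density on the line, supported in `[1, 3]`. -/
def radialBump : ℝ → ℝ :=
  (⟨1 / 2, 1, by norm_num, by norm_num⟩ : ContDiffBump (2 : ℝ)).normed volume

theorem continuous_radialBump : Continuous radialBump := ContDiffBump.continuous_normed _

theorem radialBump_nonneg (t : ℝ) : 0 ≤ radialBump t := ContDiffBump.nonneg_normed _ t

theorem integral_radialBump : ∫ t, radialBump t = 1 := ContDiffBump.integral_normed _

theorem integrable_radialBump : Integrable radialBump := ContDiffBump.integrable_normed _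

theorem mem_Ioo_of_radialBump_ne_zero {t : ℝ} (ht : radialBump t ≠ 0) : t ∈ Ioo (1 : ℝ) 3 := by
  have h : t ∈ Function.support radialBump := ht
  rw [radialBump, ContDiffBump.support_normed_eq, Real.ball_eq_Ioo] at h
  exact ⟨by linarith [h.1], by linarith [h.2]⟩

theorem radialBump_of_le {t : ℝ} (ht : t ≤ 1) : radialBump t = 0 := by
  by_contra h
  exact absurd (mem_Ioo_of_radialBump_ne_zero h).1 (not_lt.2 ht)

theorem radialBump_of_ge {t : ℝ} (ht : 3 ≤ t) : radialBump t = 0 := by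
  by_contra h
  exact absurd (mem_Ioo_of_radialBump_ne_zero h).2 (not_lt.2 ht)

/-- The bump, inverted to a weight in the radius. -/
def radialWeight (s : ℝ) : ℝ := radialBump s⁻¹ * s⁻¹

theorem radialWeight_nonneg {s : ℝ} (hs : 0 ≤ s) : 0 ≤ radialWeight s :=
  mul_nonneg (radialBump_nonneg _) (inv_nonneg.2 hs)

theorem measurable_radialWeight : Measurable radialWeight :=
  (continuous_radialBump.measurable.comp measurable_inv).mul measurable_inv

theorem radialWeight_of_ge {s : ℝ} (hs : 1 ≤ s) : radialWeight s = 0 := by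
  rw [radialWeight, radialBump_of_le (inv_le_one_of_one_le₀ hs), zero_mul]

theorem radialWeight_of_le {s : ℝ} (h0 : 0 ≤ s) (hs : s ≤ 1 / 3) : radialWeight s = 0 := by
  rcases h0.eq_or_lt with rfl | h
  · simp [radialWeight]
  · rw [radialWeight, radialBump_of_ge, zero_mul]
    rw [le_inv_comm₀ (by norm_num) h]
    linarith

theorem setIntegral_Ioi_radialBump : ∫ t in Ioi (0 : ℝ), radialBump t = 1 := by
  rw [setIntegral_eq_integral_of_forall_compl_eq_zero fun t ht => radialBump_of_le
    (by linarith [not_lt.1 (show ¬ 0 < t from ht)]), integral_radialBump]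

theorem radialBump_div_eq {t s : ℝ} : radialBump (t / s) = radialBump (s⁻¹ * t) := by
  rw [div_eq_inv_mul]

theorem integral_Ioi_radialBump_div {s : ℝ} (hs : 0 < s) :
    ∫ t in Ioi (0 : ℝ), radialBump (t / s) = s := by
  simp_rw [radialBump_div_eq]
  rw [integral_comp_mul_left_Ioi radialBump 0 (inv_pos.2 hs), mul_zero, setIntegral_Ioi_radialBump,
    inv_inv, smul_eq_mul, mul_one]

theorem integrableOn_Ioi_radialBump_div {s : ℝ} (hs : 0 < s) :
    IntegrableOn (fun t => radialBump (t / s)) (Ioi 0) :=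
  (integrable_radialBump.comp_div hs.ne').integrableOn

/-- The weight has mass 1 for the dilation-invariant measure dt/t: the integrand is s⁻¹ `radialBump`
(t/s). -/
theorem lintegral_Ioi_inv_mul_radialWeight {s : ℝ} (hs : 0 < s) :
    ∫⁻ t in Ioi (0 : ℝ), ENNReal.ofReal (t⁻¹ * radialWeight (s / t)) = 1 := by
  have h : ∀ t ∈ Ioi (0 : ℝ), ENNReal.ofReal (t⁻¹ * radialWeight (s / t)) =
      ENNReal.ofReal (s⁻¹ * radialBump (t / s)) := fun t (ht : 0 < t) => by
    rw [radialWeight, inv_div]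
    congr 1
    field_simp
  rw [setLIntegral_congr_fun measurableSet_Ioi h, ← ofReal_integral_eq_lintegral_ofReal
    ((integrableOn_Ioi_radialBump_div hs).const_mul _)
    (Eventually.of_forall fun t => mul_nonneg (inv_nonneg.2 hs.le) (radialBump_nonneg _)),
    integral_const_mul, integral_Ioi_radialBump_div hs, inv_mul_cancel₀ hs.ne', ENNReal.ofReal_one]

/-- In polar coordinates the Jacobian r cancels |z|⁻¹; the angle gives 2π and the bump gives s. -/
theorem complex_integral_inv_norm_mul_radialBump {s : ℝ} (hs : 0 < s) :
    Integrable (fun z : ℂ => ‖z‖⁻¹ * radialBump (‖z‖ / s)) ∧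
      ∫ z : ℂ, ‖z‖⁻¹ * radialBump (‖z‖ / s) = 2 * Real.pi * s := by
  have h : ∀ r ∈ Ioi (0 : ℝ), r ^ (Module.finrank ℝ ℂ - 1) • (r⁻¹ * radialBump (r / s)) =
      radialBump (r / s) := fun r (hr : 0 < r) => by
    rw [Complex.finrank_real_complex, smul_eq_mul, pow_one, mul_inv_cancel_left₀ hr.ne']
  constructor
  · refine (integrable_fun_norm_addHaar (volume : Measure ℂ)
      (f := fun r => r⁻¹ * radialBump (r / s))).2 ?_
    exact (integrableOn_Ioi_radialBump_div hs).congr_fun (fun r hr => (h r hr).symm)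
      measurableSet_Ioi
  · rw [integral_fun_norm_addHaar (volume : Measure ℂ) (fun r => r⁻¹ * radialBump (r / s)),
      setIntegral_congr_fun measurableSet_Ioi h, integral_Ioi_radialBump_div hs,
      Complex.finrank_real_complex, measureReal_def, Complex.volume_ball]
    simp
    ring

end RadialBump

theorem lintegral_comp_smul {E : Type*} [NormedAddCommGroup E] [NormedSpace ℝ E]
    [MeasurableSpace E] [BorelSpace E] [FiniteDimensional ℝ E] (μ : Measure E)
    [μ.IsAddHaarMeasure] (f : E → ENNReal) {r : ℝ} (hr : 0 < r) :
    ∫⁻ x, f (r • x) ∂μ = ENNReal.ofReal (r ^ Module.finrank ℝ E)⁻¹ * ∫⁻ x, f x ∂μ := by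
  have h := lintegral_map_equiv (μ := μ) f
    (Homeomorph.smul (Units.mk0 r hr.ne') : E ≃ₜ E).toMeasurableEquiv
  have hm : μ.map (Homeomorph.smul (Units.mk0 r hr.ne') : E ≃ₜ E).toMeasurableEquiv =
      μ.map (fun x => r • x) := rfl
  rw [hm, Measure.map_addHaar_smul μ hr.ne', lintegral_smul_measure,
    abs_of_nonneg (by positivity)] at h
  exact h.symm

/-! ### The cut-off kernel and the section volume -/

section Cutoff

variable {n : ℕ} {K : Set (RSpace n)}

/-- The homogeneous function `sectionKernel K`, cut off to an annulus. -/
def kernelCutoff (K : Set (RSpace n)) (x : RSpace n) : ℝ := sectionKernel K x * radialWeight ‖x‖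

theorem kernelCutoff_eq_zero {x : RSpace n} (hx : 1 < ‖x‖) : kernelCutoff K x = 0 := by
  rw [kernelCutoff, radialWeight_of_ge hx.le, mul_zero]

/-- The weight vanishes for radii below 1/3, which removes the singularity at 0. -/
theorem continuous_kernelCutoff (hf : ContinuousOn (sectionKernel K) {0}ᶜ) :
    Continuous (kernelCutoff K) := by
  refine continuous_iff_continuousAt.2 fun x => ?_
  by_cases hx : x = 0
  · subst hx
    have h : kernelCutoff K =ᶠ[𝓝 0] fun _ => 0 := by
      filter_upwards [Metric.ball_mem_nhds (0 : RSpace n) (show (0 : ℝ) < 1 / 3 by norm_num)]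
        with y hy
      rw [mem_ball_zero_iff] at hy
      rw [kernelCutoff, radialWeight_of_le (norm_nonneg y) hy.le, mul_zero]
    exact continuousAt_const.congr h.symm
  · have hx' : ‖x‖ ≠ 0 := norm_ne_zero_iff.2 hx
    have h1 : ContinuousAt (fun y : RSpace n => ‖y‖⁻¹) x := continuous_norm.continuousAt.inv₀ hx'
    exact (hf.continuousAt (isOpen_compl_singleton.mem_nhds hx)).mul
      ((continuous_radialBump.continuousAt.comp h1).mul h1)

/-- The integral of the cut-off kernel over a subspace of dimension `2n - 2`. -/
theorem lintegral_kernelCutoff (hn : 2 ≤ n) (hK : IsStarBody K) {R : ℝ}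
    (hR : 0 < R) (hR1 : R < 1) (hg : ∀ x, ‖x‖ ≤ R * gauge K x) (H : Submodule ℝ (RSpace n))
    (hH : Module.finrank ℝ H = 2 * n - 2) :
    ∫⁻ y : H, ENNReal.ofReal (kernelCutoff K y) = ∫⁻ y : H, bodyDensity K y := by
  have hD : Measurable (bodyDensity K) := measurable_bodyDensity hK
  have hnt : Nontrivial H := Module.nontrivial_of_finrank_pos (R := ℝ) (by omega)
  have hae : ∀ᵐ y : H, y ≠ 0 := Measure.ae_ne volume 0
  have hw : Measurable fun s : ℝ => ENNReal.ofReal (radialWeight s) :=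
    measurable_radialWeight.ennreal_ofReal
  have hmeas : Measurable (Function.uncurry fun (y : H) (t : ℝ) =>
      ENNReal.ofReal (t ^ (2 * n - 3)) * bodyDensity K (t • (y : RSpace n)) *
        ENNReal.ofReal (radialWeight ‖y‖)) := by
    refine Measurable.mul (Measurable.mul (by fun_prop) (hD.comp (by fun_prop)))
      (hw.comp (by fun_prop))
  have hmeas2 : Measurable (Function.uncurry fun (t : ℝ) (y : H) =>
      bodyDensity K (y : RSpace n) * ENNReal.ofReal (t⁻¹ * radialWeight (‖y‖ / t))) := by
    refine Measurable.mul (hD.comp (by fun_prop)) (Measurable.ennreal_ofReal ?_)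
    exact Measurable.mul (by fun_prop) (measurable_radialWeight.comp (by fun_prop))
  calc ∫⁻ y : H, ENNReal.ofReal (kernelCutoff K y)
      = ∫⁻ y : H, ∫⁻ t in Ioi (0 : ℝ), ENNReal.ofReal (t ^ (2 * n - 3)) *
          bodyDensity K (t • (y : RSpace n)) * ENNReal.ofReal (radialWeight ‖y‖) := by
        refine lintegral_congr_ae ?_
        filter_upwards [hae] with y hy
        have hy' : (y : RSpace n) ≠ 0 := fun h => hy (Subtype.ext h)
        rw [kernelCutoff, ENNReal.ofReal_mul (sectionKernel_nonneg hn hR hR1 hg _),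
          ofReal_sectionKernel hn hK hR hR1 hg hy', lintegral_mul_const' _ _ ENNReal.ofReal_ne_top]
        rfl
    _ = ∫⁻ t in Ioi (0 : ℝ), ∫⁻ y : H, ENNReal.ofReal (t ^ (2 * n - 3)) *
          bodyDensity K (t • (y : RSpace n)) * ENNReal.ofReal (radialWeight ‖y‖) :=
        lintegral_lintegral_swap hmeas.aemeasurable
    _ = ∫⁻ t in Ioi (0 : ℝ), ∫⁻ y : H,
          bodyDensity K (y : RSpace n) * ENNReal.ofReal (t⁻¹ * radialWeight (‖y‖ / t)) := by
        refine setLIntegral_congr_fun measurableSet_Ioi fun t (ht : 0 < t) => ?_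
        have hc := lintegral_comp_smul (volume : Measure H) (fun y : H =>
          ENNReal.ofReal (t ^ (2 * n - 3)) * bodyDensity K (y : RSpace n) *
            ENNReal.ofReal (radialWeight (‖y‖ / t))) ht
        have hsm : ∀ y : H, ‖t • y‖ / t = ‖y‖ := fun y => by
          rw [norm_smul, Real.norm_of_nonneg ht.le, mul_div_cancel_left₀ _ ht.ne']
        simp_rw [hsm] at hc
        refine hc.trans ?_
        rw [hH, ← lintegral_const_mul' _ _ ENNReal.ofReal_ne_top]
        refine lintegral_congr fun y => ?_
        -- The Jacobian of the dilation of H against the radial power leaves dt/t, for which the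
        -- weight is normalised.
        have e : t⁻¹ = (t ^ (2 * n - 2))⁻¹ * t ^ (2 * n - 3) := by
          have : 2 * n - 2 = (2 * n - 3) + 1 := by omega
          rw [this, pow_succ]
          field_simp
        rw [e, ENNReal.ofReal_mul (by positivity), ENNReal.ofReal_mul (by positivity)]
        ring
    _ = ∫⁻ y : H, ∫⁻ t in Ioi (0 : ℝ),
          bodyDensity K (y : RSpace n) * ENNReal.ofReal (t⁻¹ * radialWeight (‖y‖ / t)) :=
        lintegral_lintegral_swap hmeas2.aemeasurable
    _ = ∫⁻ y : H, bodyDensity K y := by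
        refine lintegral_congr_ae ?_
        filter_upwards [hae] with y hy
        rw [lintegral_const_mul _ (by
          refine Measurable.ennreal_ofReal (Measurable.mul (by fun_prop) ?_)
          exact measurable_radialWeight.comp (by fun_prop)),
          lintegral_Ioi_inv_mul_radialWeight (norm_pos_iff.2 hy), mul_one]

theorem hypSectionVolume_eq (hn : 2 ≤ n) (hK : IsStarBody K) (hball : K ⊆ Metric.ball 0 1)
    (ξ : RSpace n) :
    hypSectionVolume K ξ =
      ENNReal.ofReal (8 ^ (n - 1)) * ∫⁻ y : complexHyperplane ξ, bodyDensity K y := by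
  have hKm : MeasurableSet {x : complexHyperplane ξ | (x : RSpace n) ∈ K} :=
    hK.isCompact.isClosed.measurableSet.preimage measurable_subtype_coe
  have e : n - 1 + 1 = n := by omega
  rw [hypSectionVolume, hypMeasure, withDensity_apply _ hKm, Measure.restrict_restrict hKm,
    inter_eq_left.2 (fun x hx => by simpa using hball hx), ← lintegral_indicator hKm,
    ← lintegral_const_mul' _ _ ENNReal.ofReal_ne_top]
  refine lintegral_congr fun y => ?_
  by_cases hy : (y : RSpace n) ∈ K
  · rw [indicator_of_mem (show y ∈ {x : complexHyperplane ξ | (x : RSpace n) ∈ K} from hy),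
      bodyDensity, indicator_of_mem hy, ← ENNReal.ofReal_mul (by positivity), e, div_eq_mul_inv]
    rfl
  · rw [indicator_of_notMem (show y ∉ {x : complexHyperplane ξ | (x : RSpace n) ∈ K} from hy),
      bodyDensity, indicator_of_notMem hy, mul_zero]

theorem integrable_kernelCutoff_hyperplane (hf : ContinuousOn (sectionKernel K) {0}ᶜ)
    (x : RSpace n) : Integrable fun y : complexHyperplane x => kernelCutoff K y := by
  refine ((continuous_kernelCutoff hf).comp continuous_subtype_val).integrable_of_hasCompactSupport
    (HasCompactSupport.intro (isCompact_closedBall (0 : complexHyperplane x) 1) fun y hy =>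
      kernelCutoff_eq_zero (by simpa using hy))

theorem kernelCutoff_nonneg (hn : 2 ≤ n) {R : ℝ} (hR : 0 < R) (hR1 : R < 1)
    (hg : ∀ x, ‖x‖ ≤ R * gauge K x) (x : RSpace n) : 0 ≤ kernelCutoff K x :=
  mul_nonneg (sectionKernel_nonneg hn hR hR1 hg x) (radialWeight_nonneg (norm_nonneg x))

theorem hypSectionVolume_eq_ofReal (hn : 2 ≤ n) (hK : IsStarBody K)
    (hball : K ⊆ Metric.ball 0 1) (hf : ContinuousOn (sectionKernel K) {0}ᶜ) {R : ℝ}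
    (hR : 0 < R) (hR1 : R < 1) (hg : ∀ x, ‖x‖ ≤ R * gauge K x) {ξ : RSpace n} (hξ : ξ ≠ 0) :
    hypSectionVolume K ξ =
      ENNReal.ofReal (8 ^ (n - 1) * ∫ y : complexHyperplane ξ, kernelCutoff K y) := by
  rw [hypSectionVolume_eq hn hK hball, ← lintegral_kernelCutoff hn hK hR hR1 hg _
    (finrank_complexHyperplane hξ), ENNReal.ofReal_mul (by positivity),
    ofReal_integral_eq_lintegral_ofReal (integrable_kernelCutoff_hyperplane hf ξ)
      (Eventually.of_forall fun y => kernelCutoff_nonneg hn hR hR1 hg _)]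

end Cutoff

/-! ### Pairing the cut-off kernel with `lineFourier` -/

section FourierIdentity

variable {n : ℕ} {K : Set (RSpace n)}

/-- The integration kernel in the dilation parameter `z` that arises from `kernelCutoff K` by the
substitution `y ↦ z⁻¹ y`. -/
def dilationKernel (K : Set (RSpace n)) (y : RSpace n) (z : ℂ) : ℝ :=
  sectionKernel K y * ‖y‖⁻¹ * (‖z‖⁻¹ * radialBump (‖z‖ / ‖y‖))

/-- Homogeneity gives |z|^(2n-2) and the weight gives |z|/|y|; against the Jacobian |z|^(-2n) only
|z|⁻¹ remains. -/
theorem kernelCutoff_inv_cmul (hn : 2 ≤ n) (hrot : IsRotationInvariant K) {z : ℂ} (hz : z ≠ 0)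
    (y : RSpace n) :
    (‖z‖ ^ (2 * n))⁻¹ * kernelCutoff K (cmul n z⁻¹ y) =
      dilationKernel K y z := by
  have hz' : ‖z‖ ≠ 0 := norm_ne_zero_iff.2 hz
  have e : 2 * n = (2 * n - 2) + 2 := by omega
  rw [kernelCutoff, sectionKernel_cmul hn hrot (inv_ne_zero hz), norm_cmul, norm_inv, radialWeight,
    mul_inv, inv_inv, inv_pow, inv_inv, e, pow_add, dilationKernel, div_eq_mul_inv]
  simp only [Nat.add_sub_cancel]
  field_simp

theorem integral_kernelCutoff_mul_schwartzFourier (hn : 2 ≤ n) (hrot : IsRotationInvariant K)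
    (φ : SchwartzMap (RSpace n) ℂ) {z : ℂ} (hz : z ≠ 0) :
    ∫ y, (kernelCutoff K y : ℂ) * schwartzFourier (RSpace n) φ (cmul n z y) =
      ∫ y, ((dilationKernel K y z : ℝ) : ℂ) *
        schwartzFourier (RSpace n) φ y := by
  have h := integral_comp_cmul (fun y : RSpace n =>
    (kernelCutoff K (cmul n z⁻¹ y) : ℂ) * schwartzFourier (RSpace n) φ y) hz
  simp_rw [← cmul_mul, inv_mul_cancel₀ hz, cmul_one] at h
  rw [h, ← integral_smul]
  refine integral_congr_ae (Eventually.of_forall fun y => ?_)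
  simp only
  rw [← kernelCutoff_inv_cmul hn hrot hz, Complex.real_smul, Complex.ofReal_mul, mul_assoc]

theorem dilationKernel_nonneg (hf0 : ∀ x, 0 ≤ sectionKernel K x) (y : RSpace n) (z : ℂ) :
    0 ≤ dilationKernel K y z :=
  mul_nonneg (mul_nonneg (hf0 y) (inv_nonneg.2 (norm_nonneg _)))
    (mul_nonneg (inv_nonneg.2 (norm_nonneg _)) (radialBump_nonneg _))

theorem integral_dilationKernel (K : Set (RSpace n)) {y : RSpace n} (hy : y ≠ 0) :
    ∫ z, dilationKernel K y z = 2 * Real.pi * sectionKernel K y := by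
  have hy' : 0 < ‖y‖ := norm_pos_iff.2 hy
  simp only [dilationKernel]
  rw [integral_const_mul, (complex_integral_inv_norm_mul_radialBump hy').2]
  field_simp

theorem integrable_dilationKernel (K : Set (RSpace n)) {y : RSpace n} (hy : y ≠ 0) :
    Integrable (dilationKernel K y) :=
  (complex_integral_inv_norm_mul_radialBump (norm_pos_iff.2 hy)).1.const_mul _

variable [NeZero n]

theorem integrable_dilationKernel_mul (hfm : AEStronglyMeasurable (sectionKernel K))
    (hf0 : ∀ x, 0 ≤ sectionKernel K x) {F : RSpace n → ℂ} (hF : AEStronglyMeasurable F)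
    (hfF : Integrable fun y => (sectionKernel K y : ℂ) * F y) :
    Integrable (Function.uncurry fun (y : RSpace n) (z : ℂ) => (dilationKernel K y z : ℂ) * F y)
      (volume.prod volume) := by
  have hm : AEStronglyMeasurable (Function.uncurry fun (y : RSpace n) (z : ℂ) =>
      (dilationKernel K y z : ℂ) * F y) (volume.prod volume) := by
    refine AEStronglyMeasurable.mul (Complex.continuous_ofReal.comp_aestronglyMeasurable
      (AEStronglyMeasurable.mul (hfm.comp_fst.mul ?_) ?_)) hF.comp_fst
    · exact Measurable.aestronglyMeasurable (by fun_prop)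
    · refine Measurable.aestronglyMeasurable (Measurable.mul (by fun_prop) ?_)
      exact continuous_radialBump.measurable.comp (by fun_prop)
  rw [integrable_prod_iff hm]
  constructor
  · filter_upwards [ae_ne_zero] with y hy
    have hi : Integrable fun z => (dilationKernel K y z : ℂ) := (integrable_dilationKernel K hy).ofReal
    exact hi.mul_const (F y)
  · refine (hfF.norm.const_mul (2 * Real.pi)).congr ?_
    filter_upwards [ae_ne_zero] with y hy
    simp only [Function.uncurry_apply_pair, norm_mul, Complex.norm_real,
      Real.norm_of_nonneg (dilationKernel_nonneg hf0 y _), Real.norm_of_nonneg (hf0 y)]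
    rw [integral_mul_const, integral_dilationKernel K hy]
    ring

/-- After y ↦ z⁻¹y the test function no longer involves z, so the z-integral acts on the kernel
alone and undoes the cut-off up to 2π. -/
theorem integral_kernelCutoff_mul_lineFourier (hn : 2 ≤ n) (hrot : IsRotationInvariant K)
    (hf : ContinuousOn (sectionKernel K) {0}ᶜ) (hf0 : ∀ x, 0 ≤ sectionKernel K x) {C : ℝ}
    (hfC : ∀ x, sectionKernel K x ≤ C * (‖x‖ ^ (2 * n - 2))⁻¹) (φ : SchwartzMap (RSpace n) ℂ) :
    ∫ y, (kernelCutoff K y : ℂ) * lineFourier φ y =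
      2 * Real.pi * ∫ y, (sectionKernel K y : ℂ) * schwartzFourier (RSpace n) φ y := by
  have hfm : AEStronglyMeasurable (sectionKernel K) :=
    aestronglyMeasurable_of_continuousOn_compl_zero hf
  have hfS : Integrable fun y => (sectionKernel K y : ℂ) * schwartzFourier (RSpace n) φ y :=
    integrable_mul_schwartz (k := 2 * n - 2) (by rw [finrank_rSpace]; omega)
      (Complex.continuous_ofReal.comp_aestronglyMeasurable hfm) (C := C)
      (Eventually.of_forall fun x => by
        rw [Complex.norm_real, Real.norm_of_nonneg (hf0 x)]
        exact hfC x) _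
  have hhc := continuous_kernelCutoff hf
  obtain ⟨M, hM⟩ : ∃ M, ∀ y, ‖kernelCutoff K y‖ ≤ M :=
    hhc.bounded_above_of_compact_support (HasCompactSupport.intro
      (isCompact_closedBall (0 : RSpace n) 1) fun y hy =>
        kernelCutoff_eq_zero (by simpa using hy))
  have hM0 : 0 ≤ M := (norm_nonneg _).trans (hM 0)
  have hdecay : ∀ y, ‖(kernelCutoff K y : ℂ)‖ ≤
      M * 2 ^ (2 * n + 1) * ((1 + ‖y‖) ^ (2 * n + 1))⁻¹ := fun y => by
    rw [Complex.norm_real]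
    by_cases hy : 1 < ‖y‖
    · rw [kernelCutoff_eq_zero hy, norm_zero]
      positivity
    · rw [← div_eq_mul_inv, le_div_iff₀ (by positivity)]
      exact mul_le_mul (hM y) (pow_le_pow_left₀ (by positivity) (by linarith) _)
        (by positivity) hM0
  have h1 := integrable_mul_schwartzFourier_cmul hn
    (h := fun y => (kernelCutoff K y : ℂ))
    (Complex.continuous_ofReal.comp hhc).aestronglyMeasurable (by positivity) hdecay φ
  have h2 := integrable_dilationKernel_mul hfm hf0
    (schwartzFourier (RSpace n) φ).continuous.aestronglyMeasurable hfS
  calc ∫ y, (kernelCutoff K y : ℂ) * lineFourier φ y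
      = ∫ y, ∫ z : ℂ, (kernelCutoff K y : ℂ) * schwartzFourier (RSpace n) φ (cmul n z y) := by
        simp_rw [lineFourier, ← integral_const_mul]
    _ = ∫ z : ℂ, ∫ y, (kernelCutoff K y : ℂ) * schwartzFourier (RSpace n) φ (cmul n z y) :=
        integral_integral_swap h1
    _ = ∫ z : ℂ, ∫ y, (dilationKernel K y z : ℂ) * schwartzFourier (RSpace n) φ y := by
        refine integral_congr_ae ?_
        filter_upwards [Measure.ae_ne (volume : Measure ℂ) 0] with z hz
        exact integral_kernelCutoff_mul_schwartzFourier hn hrot φ hz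
    _ = ∫ y, ∫ z : ℂ, (dilationKernel K y z : ℂ) * schwartzFourier (RSpace n) φ y :=
        (integral_integral_swap h2).symm
    _ = ∫ y, 2 * Real.pi * ((sectionKernel K y : ℂ) * schwartzFourier (RSpace n) φ y) := by
        refine integral_congr_ae ?_
        filter_upwards [ae_ne_zero] with y hy
        have hi : ∫ z, (dilationKernel K y z : ℂ) = ((∫ z, dilationKernel K y z : ℝ) : ℂ) := integral_ofReal
        rw [integral_mul_const, hi, integral_dilationKernel K hy]
        push_cast
        ring
    _ = _ := integral_const_mul _ _

end FourierIdentity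

/-! ### Locally integrable kernels as tempered distributions -/

section Distribution

variable {E : Type*} [NormedAddCommGroup E] [InnerProductSpace ℝ E] [FiniteDimensional ℝ E]
  [MeasurableSpace E] [BorelSpace E] [Nontrivial E]

/-- A nonnegative function with an integrable power singularity at the origin is a tempered
distribution. -/
theorem exists_isGivenBy {f : E → ℝ} (hf : Measurable f) (hf0 : ∀ x, 0 ≤ f x) {k : ℕ}
    (hk : k < Module.finrank ℝ E) {C : ℝ} (hC : ∀ x, f x ≤ C * (‖x‖ ^ k)⁻¹) :
    ∃ T : TemperedDistribution E ℂ, IsGivenBy T f := by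
  -- Nonnegativity lets f be the density of a measure; temperate growth of that measure supplies the
  -- distribution.
  set μ : Measure E := volume.withDensity fun x => ENNReal.ofReal (f x) with hμ
  have hfin : ∀ᵐ x : E, ENNReal.ofReal (f x) < ⊤ := Eventually.of_forall fun x =>
    ENNReal.ofReal_lt_top
  have hT : μ.HasTemperateGrowth := by
    refine ⟨Module.finrank ℝ E + 1, ?_⟩
    rw [hμ, integrable_withDensity_iff_integrable_smul' hf.ennreal_ofReal hfin]
    refine ((integrable_inv_norm_pow_mul hk).const_mul C).mono'
      (Measurable.aestronglyMeasurable (by fun_prop)) (Eventually.of_forall fun x => ?_)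
    rw [ENNReal.toReal_ofReal (hf0 x), smul_eq_mul, Real.rpow_neg (by positivity),
      Real.rpow_natCast, Real.norm_of_nonneg (mul_nonneg (hf0 x) (by positivity)), ← mul_assoc]
    exact mul_le_mul_of_nonneg_right (hC x) (by positivity)
  refine ⟨μ.toTemperedDistribution, fun φ => ⟨?_, ?_⟩⟩
  · refine integrable_mul_schwartz hk (by fun_prop) (C := C) (Eventually.of_forall fun x => ?_) φ
    rw [Complex.norm_real, Real.norm_of_nonneg (hf0 x)]
    exact hC x
  · rw [Measure.toTemperedDistribution_apply μ φ, hμ,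
      integral_withDensity_eq_integral_toReal_smul hf.ennreal_ofReal hfin]
    refine integral_congr_ae (Eventually.of_forall fun x => ?_)
    simp only
    rw [ENNReal.toReal_ofReal (hf0 x), Complex.real_smul]

end Distribution

end

end ComplexHyperbolic

/-! ### Assembly of the theorem -/

open ComplexHyperbolic in
theorem lemma5 (n : ℕ) (hn : 2 ≤ n) (K : Set (RSpace n))
    (hK : IsStarBody K) (hcont : Continuous (gauge K)) (hrot : IsRotationInvariant K)
    (hball : K ⊆ Metric.ball 0 1) :
    ∃ T : TemperedDistribution (RSpace n) ℂ, IsGivenBy T (sectionKernel K) ∧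
      ∃ g : RSpace n → ℝ, ContinuousOn g {0}ᶜ ∧ IsGivenBy (distFourier T) g ∧
        ∀ ξ : RSpace n, ‖ξ‖ = 1 →
          hypSectionVolume K ξ ≠ ⊤ ∧
          (hypSectionVolume K ξ).toReal = 8 ^ (n - 1) / (2 * Real.pi) * g ξ := by
  have : NeZero n := ⟨by omega⟩
  obtain ⟨R, hR, hR1, hg⟩ := hK.exists_radius hball
  have hf := continuousOn_sectionKernel hn hcont hR hR1 hg
  have hf0 := sectionKernel_nonneg hn hR hR1 hg
  obtain ⟨C, -, hC⟩ := exists_sectionKernel_le hn hR hR1 hg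
  obtain ⟨T, hT⟩ := exists_isGivenBy (measurable_of_continuousOn_compl_singleton 0 hf) hf0
    (by rw [finrank_rSpace]; omega) hC
  set h : RSpace n → ℂ := fun y => (kernelCutoff K y : ℂ) with hh
  have hhc : Continuous h := Complex.continuous_ofReal.comp (continuous_kernelCutoff hf)
  have hhR : ∀ y, 1 < ‖y‖ → h y = 0 := fun y hy => by
    rw [hh]
    simp only [kernelCutoff_eq_zero hy, Complex.ofReal_zero]
  set I : RSpace n → ℝ := fun x =>
    MeasureTheory.integral MeasureTheory.volume
      fun y : complexHyperplane x => kernelCutoff K y with hI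
  have hIc : ∀ x, hyperplaneIntegral h x = I x := fun x => integral_ofReal
  have hIcont : ContinuousOn I {0}ᶜ :=
    (Complex.continuous_re.comp_continuousOn (continuousOn_hyperplaneIntegral hhc hhR)).congr
      fun x _ => by rw [Function.comp_apply, hIc, Complex.ofReal_re]
  obtain ⟨M, hM⟩ := hhc.bounded_above_of_compact_support (HasCompactSupport.intro
    (isCompact_closedBall (0 : RSpace n) 1) fun y hy => hhR y (by simpa using hy))
  -- The slice factor (2π)² |x|^(-2) divided by the 2π produced by the z-integral.
  set g : RSpace n → ℝ := fun x => 2 * Real.pi * (‖x‖ ^ 2)⁻¹ * I x with hgdef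
  have hgcont : ContinuousOn g {0}ᶜ := by
    refine ContinuousOn.mul (ContinuousOn.mul (by fun_prop)
      (ContinuousOn.inv₀ (by fun_prop) fun x hx => ?_)) hIcont
    exact pow_ne_zero _ (norm_ne_zero_iff.2 hx)
  refine ⟨T, hT, g, hgcont, fun φ => ⟨?_, ?_⟩, fun ξ hξ => ?_⟩
  · set V := MeasureTheory.volume.real
      (Metric.closedBall (0 : EuclideanSpace ℝ (Fin (2 * n - 2))) 1)
    refine integrable_mul_schwartz (k := 2) (by rw [finrank_rSpace]; omega)
      (Complex.continuous_ofReal.comp_aestronglyMeasurable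
        (aestronglyMeasurable_of_continuousOn_compl_zero hgcont))
      (C := 2 * Real.pi * (M * V)) ?_ φ
    filter_upwards [ae_ne_zero] with x hx
    have hb := norm_hyperplaneIntegral_le hhR hM hx
    rw [hIc] at hb
    rw [Complex.ofReal_mul, norm_mul, Complex.norm_real (2 * Real.pi * (‖x‖ ^ 2)⁻¹),
      Real.norm_of_nonneg (by positivity)]
    calc 2 * Real.pi * (‖x‖ ^ 2)⁻¹ * ‖(I x : ℂ)‖
        ≤ 2 * Real.pi * (‖x‖ ^ 2)⁻¹ * (M * V) := by gcongr
      _ = _ := by ring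
  · have h1 := integral_kernelCutoff_mul_lineFourier hn hrot hf hf0 hC φ
    have h2 := integral_hyperplaneIntegral_eq hn hhc hhR φ
    have hpi : (2 * Real.pi : ℂ) ≠ 0 := by exact_mod_cast Real.two_pi_pos.ne'
    rw [distFourier_apply, (hT _).2]
    -- Both 2π ∫ f φ^ and (2π)² ∫ φ |x|^(-2) I equal the pairing of h with `lineFourier φ`.
    refine mul_left_cancel₀ hpi (h1.symm.trans (h2.symm.trans ?_))
    rw [← MeasureTheory.integral_const_mul]
    congr 1
    funext x
    rw [hIc, hgdef]
    push_cast
    ring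
  · have hξ0 : ξ ≠ 0 := norm_ne_zero_iff.1 (by rw [hξ]; exact one_ne_zero)
    have hI0 : 0 ≤ I ξ := MeasureTheory.integral_nonneg fun y =>
      kernelCutoff_nonneg hn hR hR1 hg _
    have hv := hypSectionVolume_eq_ofReal hn hK hball hf hR hR1 hg hξ0
    refine ⟨hv ▸ ENNReal.ofReal_ne_top, ?_⟩
    rw [hv, ENNReal.toReal_ofReal (mul_nonneg (by positivity) hI0), hgdef]
    simp only [hξ, hI]
    field_simp
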